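/- **Setting.** Let $\tilde V=V\cup\{\delta\}$ be a finite set with a distinguished point $\delta\notin V$ and let $W=(W_{ij})_{i,j\in\tilde V}$ be symmetric weights, $W_{ij}\ge 0$, $W_{ii}=0$, such that the graph $\tilde G$ on $\tilde V$ with edges $i\sim j\iff W_{ij}>0$ is connected. For $u\in\mathbb R^{\tilde V}$ let $A^W_{ij}(u)=-W_{ij}e^{u_i+u_j}$ for $i\ne j$ and $A^W_{ii}(u)=\sum_{k\in\tilde V}W_{ik}e^{u_i+u_k}$, and let $A^W_{VV}$ be the restriction to $V\times V$. On $\Omega_V=\{(u,s)\in\mathbb R^{\tilde V}\times\mathbb R^{\tilde V}:u_\delta=s_\delta=0\}$ let $$\mu^W(du\,ds)=e^{-\frac12\langle s,A^W(u)s\rangle}\det A^W_{VV}(u)\prod_{\{i\sim j\}}e^{-W_{ij}(\cosh(u_i-u_j)-1)}\prod_{i\in V}\frac{e^{-u_i}}{2\pi}\,du_i\,ds_i .$$ For $i\in V$ put $\beta_i^{V}(u)=\frac12\sum_{j\in\tilde V}W_{ij}e^{u_j-u_i}$ and $\theta^{V}_i(u,s)=e^{-u_i}\,(A^W_{VV}(u)s_V)_i$,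 where $s_V=(s_j)_{j\in V}$. Let $V_\infty$ be the infinite vertex set of a graph with edge weights $W_{ij}=W_{ji}\ge0$, $W_{ii}=0$ ($i\sim j$ iff $W_{ij}>0$), with $\sum_jW_{ij}<\infty$ for every $i$. Let $V_0\subseteq V_1\subseteq\cdots$ be finite subsets of $V_\infty$ with union $V_\infty$. Let $\tilde G_n$ be the graph on $\tilde V_n=V_n\cup\{\delta_n\}$ with wired boundary conditions, i.e. with weights $W^{(n)}_{ij}=W_{ij}$ for $i,j\in V_n$, $W^{(n)}_{i\delta_n}=W^{(n)}_{\delta_ni}=\sum_{j\in V_\infty\setminus V_n}W_{ij}$ and $W^{(n)}_{\delta_n\delta_n}=0$. Assume that each $\tilde G_n$ is connected (which holds in particular if the infinite graph is connected). Let $\mu^W_n$ be the measure $\mu^{W^{(n)}}$ on $\Omega_{V_n}$. An *infinite-volume field* consists of real random variables $\boldsymbol\beta_i,\boldsymbol\theta_i$, $i\in V_\infty$, on a probability space $(\Omega_\infty,\mathcal F_\infty,\mu_\infty^W)$ such that, for every $n$, the law of $\boldsymbol\beta^{(n)}=(\boldsymbol\beta_i)_{i\in V_n}$, $\boldsymbol\theta^{(n)}=(\boldsymbol\theta_i)_{i\in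 V_n}$ is the law of $(\beta^{V_n},\theta^{V_n})$ under $\mu^W_n$. **Theorem.** 1. An infinite-volume field exists; it can be realized by the coordinates on $(\mathbb R\times\mathbb R)^{V_\infty}$. 2. For every $n$ there is a measurable function $f_n:\mathbb R^{V_n}\to\mathbb R^{\tilde V_n}$ with $f_n(\beta^{V_n}(u))=u$ for all $u\in\mathbb R^{\tilde V_n}$ with $u_{\delta_n}=0$. 3. For every infinite-volume field on any probability space, and any functions $f_n$ as in 2, let $u^{(n)}=f_n(\boldsymbol\beta^{(n)})$, and let $s^{(n)}\in\mathbb R^{\tilde V_n}$ be given by $s^{(n)}_{\delta_n}=0$ and $$(s^{(n)}_i)_{i\in V_n}=A^{W^{(n)}}_{V_nV_n}(u^{(n)})^{-1}\big(e^{u^{(n)}_i}\boldsymbol\theta_i\big)_{i\in V_n}$$ (the inverse, which exists almost surely, being read as $0$ where the matrix is singular). Let $\alpha\in(-\infty,0]^{V_\infty}$ have only finitely many nonzero entries, and put $\alpha^{(n)}_i=\alpha_i$ for $i\in V_n$ and $\alpha^{(n)}_{\delta_n}=\sum_{j\in V_\infty\setminus V_n}\alpha_j$. Then $$M^{(n)}_\alpha=\exp\Big(\sum_{j\in\tilde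 V_n}\alpha^{(n)}_j\,e^{u^{(n)}_j}\,\big(1+i\,s^{(n)}_j\big)\Big),\qquad n\in\mathbb N,$$ is a $\mathbb C$-valued martingale with respect to the filtration $\mathcal F_n=\sigma(\boldsymbol\beta^{(n)},\boldsymbol\theta^{(n)})$. -/

import Mathlib

open MeasureTheory ProbabilityTheory

namespace H22

/-- A graph on the vertex set `V`, without loops or parallel edges, with symmetric edge
weights: `W i j > 0` if `i ~ j` is an edge, and `W i j = 0` otherwise.  The edge set is
determined by the weights, see `WeightedGraph.graph`. -/
structure WeightedGraph (V : Type*) where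
  W : V → V → ℝ
  symm : ∀ i j, W i j = W j i
  nonneg : ∀ i j, 0 ≤ W i j
  loopless : ∀ i, W i i = 0

namespace WeightedGraph

/-- The underlying graph: `i ~ j` if and only if `W i j > 0`. -/
def graph {V : Type*} (G : WeightedGraph V) : SimpleGraph V where
  Adj i j := 0 < G.W i j
  symm := ⟨fun i j h => by rw [G.symm j i]; exact h⟩
  loopless := ⟨fun i h => by rw [G.loopless i] at h; exact lt_irrefl 0 h⟩

/-- The contribution `W i j (cosh (u i - u j) - 1)` of the undirected edge `i ~ j`. -/
noncomputable def edgeEnergy {V : Type*} (G : WeightedGraph V) (u : V → ℝ) : Sym2 V → ℝ :=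
  Sym2.lift ⟨fun i j => G.W i j * (Real.cosh (u i - u j) - 1), fun i j => by
    dsimp only
    rw [G.symm i j, ← Real.cosh_neg (u i - u j), neg_sub]⟩

/-- The matrix `A^W(u)`, indexed by all vertices. -/
noncomputable def A {V : Type*} [Fintype V] [DecidableEq V] (G : WeightedGraph V)
    (u : V → ℝ) : Matrix V V ℝ :=
  Matrix.of fun i j =>
    if i = j then ∑ k, G.W i k * Real.exp (u i + u k)
    else -(G.W i j * Real.exp (u i + u j))

/-! Finite graphs with a distinguished vertex `δ`: the vertex set is `Option ι`, where
`none` is `δ` and `ι` is the set of the other vertices. -/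

/-- Extend a field on `ι` to `Option ι` by the value `0` at `δ`. -/
def pin {ι : Type*} (x : ι → ℝ) : Option ι → ℝ
  | none => 0
  | some i => x i

section Finite

variable {ι : Type*} [Fintype ι] [DecidableEq ι]

/-- The restriction of `A^W(u)` to the vertices different from `δ`. -/
noncomputable def AVV (G : WeightedGraph (Option ι)) (u : Option ι → ℝ) : Matrix ι ι ℝ :=
  (G.A u).submatrix some some

open Classical in
/-- The density `ρ^W(u, s)`. -/
noncomputable def rho (G : WeightedGraph (Option ι)) (u s : Option ι → ℝ) : ℝ :=
  Real.exp (-(1 / 2) * (s ⬝ᵥ (G.A u).mulVec s)) * (G.AVV u).det *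
    ∏ e ∈ G.graph.edgeFinset, Real.exp (-G.edgeEnergy u e)

/-- The `H^{2|2}` measure `μ^W(du ds) = ρ^W(u, s) ∏ᵢ (2π)⁻¹ e^{-uᵢ} duᵢ dsᵢ`, the fields
being pinned to `0` at `δ`. -/
noncomputable def sigmaMeasure (G : WeightedGraph (Option ι)) :
    Measure ((ι → ℝ) × (ι → ℝ)) :=
  volume.withDensity fun x =>
    ENNReal.ofReal (G.rho (pin x.1) (pin x.2) * ∏ i, (Real.exp (-x.1 i) / (2 * Real.pi)))

/-- The variables `βᵢ(u) = ½ ∑ⱼ Wᵢⱼ e^{uⱼ - uᵢ}`, `i ≠ δ`. -/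
noncomputable def beta (G : WeightedGraph (Option ι)) (u : Option ι → ℝ) (i : ι) : ℝ :=
  1 / 2 * ∑ j, G.W (some i) j * Real.exp (u j - u (some i))

/-- The variables `θ(u, s) = e^{-u} A_{VV}(u) s_V`, indexed by `i ≠ δ`. -/
noncomputable def theta (G : WeightedGraph (Option ι)) (u s : Option ι → ℝ) (i : ι) : ℝ :=
  Real.exp (-u (some i)) * (G.AVV u).mulVec (fun j => s (some j)) i

/-- The pair `(β, θ)` as a function of the pinned configuration `(u, s)`. -/
noncomputable def betaTheta (G : WeightedGraph (Option ι))
    (x : (ι → ℝ) × (ι → ℝ)) : (ι → ℝ) × (ι → ℝ) :=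
  (G.beta (pin x.1), G.theta (pin x.1) (pin x.2))

/-- `f` is a measurable function that recovers `u` from `β(u)`, for all `u` with `u_δ = 0`. -/
def RecoversU (G : WeightedGraph (Option ι)) (f : (ι → ℝ) → Option ι → ℝ) : Prop :=
  Measurable f ∧ ∀ u : Option ι → ℝ, u none = 0 → f (G.beta u) = u

/-- The function `g(β, θ) = s` built from `f`: `s_δ = 0` and
`s_V = A_{VV}(f(β))⁻¹ e^{f(β)} θ`. -/
noncomputable def recoverS (G : WeightedGraph (Option ι)) (f : (ι → ℝ) → Option ι → ℝ)
    (b t : ι → ℝ) : Option ι → ℝ :=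
  pin ((G.AVV (f b))⁻¹.mulVec fun i => Real.exp (f b (some i)) * t i)

end Finite

/-- The finite graph on `S ∪ {δ}` obtained from `G` with wired boundary conditions. -/
noncomputable def wired {V : Type*} (G : WeightedGraph V) (S : Finset V) :
    WeightedGraph (Option S) where
  W
    | some i, some j => G.W i j
    | some i, none => ∑' j : {j : V // j ∉ S}, G.W i j
    | none, some i => ∑' j : {j : V // j ∉ S}, G.W i j
    | none, none => 0
  symm i j := by
    cases i <;> cases j <;> first | rfl | exact G.symm _ _
  nonneg i j := by
    cases i <;> cases j
    · exact le_rfl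
    · exact tsum_nonneg fun _ => G.nonneg _ _
    · exact tsum_nonneg fun _ => G.nonneg _ _
    · exact G.nonneg _ _
  loopless i := by
    cases i
    · rfl
    · exact G.loopless _

end WeightedGraph

/-- Random variables `β i`, `θ i` (`i ∈ V_∞`) on `Ω` such that for every `n` the law of
`(β i, θ i)_{i ∈ V_n}` is the law of `(β, θ)` under the `H^{2|2}` measure of the `n`-th
wired graph. -/
structure IsInfiniteVolumeField {V : Type*} [DecidableEq V] {Ω : Type*} [MeasurableSpace Ω]
    (G : WeightedGraph V) (Vn : ℕ → Finset V) (P : Measure Ω) (β θ : V → Ω → ℝ) : Prop where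
  measurable_beta : ∀ i, Measurable (β i)
  measurable_theta : ∀ i, Measurable (θ i)
  law : ∀ n,
    P.map (fun ω => ((fun i : Vn n => β i ω), (fun i : Vn n => θ i ω))) =
      (G.wired (Vn n)).sigmaMeasure.map (G.wired (Vn n)).betaTheta

/-- The filtration `ℱ n = σ(β⁽ⁿ⁾, θ⁽ⁿ⁾)`. -/
def fieldFiltration {V Ω : Type*} [mΩ : MeasurableSpace Ω] {Vn : ℕ → Finset V}
    (hmono : Monotone Vn) {β θ : V → Ω → ℝ} (hβ : ∀ i, Measurable (β i))
    (hθ : ∀ i, Measurable (θ i)) : Filtration ℕ mΩ where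
  seq n := MeasurableSpace.comap
    (fun ω => ((fun i : Vn n => β i ω), (fun i : Vn n => θ i ω))) inferInstance
  mono' m n hmn := by
    let r : ((Vn n → ℝ) × (Vn n → ℝ)) → ((Vn m → ℝ) × (Vn m → ℝ)) := fun x =>
      ((fun i => x.1 ⟨i, hmono hmn i.2⟩), (fun i => x.2 ⟨i, hmono hmn i.2⟩))
    have hr : Measurable r := by fun_prop
    exact (hr.comp (comap_measurable
      (fun ω => ((fun i : Vn n => β i ω), (fun i : Vn n => θ i ω))))).comap_le
  le' n := Measurable.comap_le (by fun_prop)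

/-- The parameters `α⁽ⁿ⁾`: `α` on `S = V_n`, and the sum of `α` over the complement of `S`
at `δ`. -/
noncomputable def wiredParam {V : Type*} [DecidableEq V] (α : V →₀ ℝ) (S : Finset V) :
    Option S → ℝ
  | none => ∑ j ∈ α.support \ S, α j
  | some i => α i

/-- `exp (∑ⱼ aⱼ e^{uⱼ} (1 + i sⱼ))`. -/
noncomputable def generatingFn {κ : Type*} [Fintype κ] (a u s : κ → ℝ) : ℂ :=
  Complex.exp (∑ j, (a j : ℂ) * (Real.exp (u j) : ℂ) * (1 + Complex.I * (s j : ℂ)))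

/-- The sequence `M⁽ⁿ⁾_α`, with `u⁽ⁿ⁾ = f_n(β⁽ⁿ⁾)` and `s⁽ⁿ⁾ = g_n(β⁽ⁿ⁾, θ⁽ⁿ⁾)`. -/
noncomputable def generatingSeq {V : Type*} [DecidableEq V] {Ω : Type*}
    (G : WeightedGraph V) (Vn : ℕ → Finset V)
    (f : (n : ℕ) → (Vn n → ℝ) → Option (Vn n) → ℝ) (β θ : V → Ω → ℝ) (α : V →₀ ℝ)
    (n : ℕ) (ω : Ω) : ℂ :=
  generatingFn (wiredParam α (Vn n))
    (f n fun i => β i ω)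
    ((G.wired (Vn n)).recoverS (f n) (fun i => β i ω) (fun i => θ i ω))

end H22

/-!
On the region where `H_β = 2β - W` is positive definite, the change of variables
`(u, s) ↦ (β, θ)` turns the `H^{2|2}` measure into an explicit density.  Writing `W` for the
weights between the vertices different from `δ`, `η` for the weights to `δ` and `H = H_β`, one has
`e^u = H⁻¹ η`, `e^u s = H⁻¹ θ` and `A_{VV}(u) = e^u H e^u`, and the law of `(β, θ)` has density

`π^{-n} exp (-½ (⟨1, H 1⟩ + ⟨η, H⁻¹ η⟩ - 2 ⟨η, 1⟩ + ⟨θ, H⁻¹ θ⟩)) / det H`   on `{H > 0}`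

(`map_betaTheta_sigmaMeasure`).  Connectedness enters twice: `H_{β(u)}` is positive definite by the
Dirichlet form of `A(u)` (`posDef_opOfField`), and conversely `H⁻¹ η` has positive entries whenever
`H` is positive definite (`inv_mulVec_outerW_pos`), so that `u ↦ β(u)` is a bijection onto
`{H_β > 0}` with inverse `log (H⁻¹ η)`.

The generating function is `exp (α_δ + ⟨α, H⁻¹ (η + i θ)⟩)`.  Splitting off one vertex `x` by a
Schur complement, this function times the density factorizes into the same expression for the graph in
which `x` is contracted to `δ`, with `α_x` added to `α_δ`, and a kernel in `(β_x, θ_x)`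
(`dens_option`, `genF_option`).  The integral of the kernel is a Gaussian integral in `θ_x`
followed by a reciprocal inverse Gaussian integral in `β_x`
(`integrable_and_integral_vertexKernel`).  The sign condition `α ≤ 0` bounds the generating function
by `1` and keeps the parameter of the latter integral nonnegative.  Taking out the vertices one
by one gives the normalization (`isProbabilityMeasure_law`), the consistency of the wired laws
(`wiredLaw_map_restrictPair`) and, as contracting vertices to `δ` is what wired boundary
conditions do, the martingale property (`integral_wiredGen_restrictPair`).

The infinite-volume field is the inverse limit of the consistent wired laws, constructed by the
Ionescu-Tulcea theorem from regular conditional laws (`exists_inverseLimit`).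
-/

namespace H22

/-! ### One-dimensional integrals -/

open Filter Topology Set in
/-- The reciprocal inverse Gaussian integral.  An antiderivative of the integrand times
`e^q` is `E(√S - q/√S) + e^{2q} E(√S + q/√S)`, where `E` is the primitive of `e^{-t²/2}`. -/
lemma integrableOn_and_integral_recipInvGauss {q : ℝ} (hq : 0 ≤ q) :
    IntegrableOn (fun S : ℝ => (√S)⁻¹ * Real.exp (-(S + q ^ 2 / S) / 2)) (Ioi 0) ∧
      ∫ S in Ioi (0 : ℝ), (√S)⁻¹ * Real.exp (-(S + q ^ 2 / S) / 2) =
        √(2 * Real.pi) * Real.exp (-q) := by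
  set φ : ℝ → ℝ := fun t => Real.exp (-(1 / 2) * t ^ 2) with hφ
  have hφc : Continuous φ := by fun_prop
  have hφi : Integrable φ := integrable_exp_neg_mul_sq (by norm_num)
  set c : ℝ := √(2 * Real.pi) / 2 with hc
  have hI : ∫ t in Ioi (0 : ℝ), φ t = c := by
    rw [hφ, integral_gaussian_Ioi, hc]
    congr 2
    ring
  set E : ℝ → ℝ := fun x => ∫ t in (0 : ℝ)..x, φ t with hE
  have hEd : ∀ x, HasDerivAt E (φ x) x := fun x => (hφc.integral_hasStrictDerivAt 0 x).hasDerivAt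
  have hEc : Continuous E := continuous_iff_continuousAt.2 fun x => (hEd x).continuousAt
  have hEtop : Tendsto E atTop (𝓝 c) := by
    rw [← hI]
    exact intervalIntegral_tendsto_integral_Ioi 0 hφi.integrableOn tendsto_id
  have hEodd : ∀ x, E (-x) = -E x := by
    intro x
    have h := intervalIntegral.integral_comp_neg (a := 0) (b := x) φ
    have h2 : (fun t => φ (-t)) = φ := by
      ext t
      simp [hφ]
    rw [h2, neg_zero] at h
    simp only [hE]
    rw [h, intervalIntegral.integral_symm]
  have hEbot : Tendsto E atBot (𝓝 (-c)) := by
    have h := (hEtop.comp tendsto_neg_atBot_atTop).neg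
    refine h.congr fun x => ?_
    simp [hEodd]
  set g : ℝ → ℝ := fun S => E (√S - q / √S) + Real.exp (2 * q) * E (√S + q / √S) with hg
  set l : ℝ := -c + Real.exp (2 * q) * c with hl
  set g' : ℝ → ℝ := fun S => Real.exp q * ((√S)⁻¹ * Real.exp (-(S + q ^ 2 / S) / 2)) with hg'
  have hderiv : ∀ S ∈ Ioi (0 : ℝ), HasDerivAt g (g' S) S := by
    intro S hS
    have hS : 0 < S := hS
    have hr : 0 < √S := Real.sqrt_pos.2 hS
    have hsq : √S ^ 2 = S := Real.sq_sqrt hS.le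
    have h1 : HasDerivAt (fun S : ℝ => √S) (1 / (2 * √S)) S := Real.hasDerivAt_sqrt hS.ne'
    have h2 : HasDerivAt (fun S : ℝ => q / √S) (-(q * (1 / (2 * √S))) / √S ^ 2) S := by
      simpa using (hasDerivAt_const S q).fun_div h1 hr.ne'
    have h3 := (hEd (√S - q / √S)).comp S (h1.sub h2)
    have h4 := ((hEd (√S + q / √S)).comp S (h1.add h2)).const_mul (Real.exp (2 * q))
    refine (h3.add h4).congr_deriv ?_
    have e1 : φ (√S - q / √S) = Real.exp q * Real.exp (-(S + q ^ 2 / S) / 2) := by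
      simp only [hφ]
      rw [← Real.exp_add]
      congr 1
      rw [← hsq]
      simp only [Real.sqrt_sq hr.le]
      field_simp
      ring
    have e2 : Real.exp (2 * q) * φ (√S + q / √S) =
        Real.exp q * Real.exp (-(S + q ^ 2 / S) / 2) := by
      simp only [hφ]
      rw [← Real.exp_add, ← Real.exp_add]
      congr 1
      rw [← hsq]
      simp only [Real.sqrt_sq hr.le]
      field_simp
      ring
    rw [← mul_assoc, e1, e2, hg']
    field_simp
    ring
  have hdivtop : Tendsto (fun S : ℝ => q / √S) atTop (𝓝 0) :=
    tendsto_const_nhds.div_atTop Real.tendsto_sqrt_atTop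
  have htop : Tendsto g atTop (𝓝 (c + Real.exp (2 * q) * c)) := by
    refine (hEtop.comp ?_).add ((hEtop.comp ?_).const_mul _)
    · simpa [sub_eq_add_neg] using Real.tendsto_sqrt_atTop.atTop_add hdivtop.neg
    · exact Real.tendsto_sqrt_atTop.atTop_add hdivtop
  have hzero : Tendsto g (𝓝[>] 0) (𝓝 l) := by
    have hs0 : Tendsto (fun S : ℝ => √S) (𝓝[>] 0) (𝓝 0) := by
      have := (Real.continuous_sqrt.tendsto 0).mono_left (nhdsWithin_le_nhds (s := Ioi (0 : ℝ)))
      simpa using this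
    rcases hq.eq_or_lt with rfl | hq
    · have h0 : E 0 = 0 := by simp [hE]
      have h1 : Tendsto (fun S : ℝ => E (√S)) (𝓝[>] 0) (𝓝 0) := by
        have := (hEc.tendsto 0).comp hs0
        rwa [h0] at this
      simpa [hg, hl] using h1.add h1
    · have hs1 : Tendsto (fun S : ℝ => √S) (𝓝[>] 0) (𝓝[>] 0) := by
        refine tendsto_nhdsWithin_iff.2 ⟨hs0, ?_⟩
        filter_upwards [self_mem_nhdsWithin] with S hS
        exact Real.sqrt_pos.2 hS
      have hs2 : Tendsto (fun S : ℝ => q / √S) (𝓝[>] 0) atTop := by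
        simpa [div_eq_mul_inv] using (tendsto_inv_nhdsGT_zero.comp hs1).const_mul_atTop hq
      refine (hEbot.comp ?_).add ((hEtop.comp ?_).const_mul _)
      · simpa [sub_eq_add_neg] using hs0.add_atBot (tendsto_neg_atTop_atBot.comp hs2)
      · exact hs0.add_atTop hs2
  have hcont : ContinuousWithinAt (Function.update g 0 l) (Ici 0) 0 := by
    rw [continuousWithinAt_update_same]
    simpa using hzero
  have hderiv' : ∀ S ∈ Ioi (0 : ℝ), HasDerivAt (Function.update g 0 l) (g' S) S := by
    intro S hS
    refine (hderiv S hS).congr_of_eventuallyEq ?_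
    filter_upwards [isOpen_Ioi.mem_nhds hS] with y hy
    exact Function.update_of_ne (ne_of_gt hy) _ _
  have htop' : Tendsto (Function.update g 0 l) atTop (𝓝 (c + Real.exp (2 * q) * c)) := by
    refine htop.congr' ?_
    filter_upwards [eventually_gt_atTop 0] with y hy
    exact (Function.update_of_ne (ne_of_gt hy) _ _).symm
  have hpos : ∀ S ∈ Ioi (0 : ℝ), 0 ≤ g' S := fun S _ => by positivity
  have hint := integrableOn_Ioi_deriv_of_nonneg hcont hderiv' hpos htop'
  have hval := integral_Ioi_of_hasDerivAt_of_nonneg hcont hderiv' hpos htop'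
  have hex : Real.exp (-q) * Real.exp q = 1 := by rw [← Real.exp_add]; simp
  have hfun : ∀ S, (√S)⁻¹ * Real.exp (-(S + q ^ 2 / S) / 2) = Real.exp (-q) * g' S := by
    intro S
    rw [hg', ← mul_assoc, hex, one_mul]
  simp_rw [hfun]
  refine ⟨hint.const_mul _, ?_⟩
  rw [integral_const_mul, hval, Function.update_self, hl, hc]
  ring

/-- The factor that a vertex contributes to the density: `S = 2 b - p` is its Schur complement
and `t + c` its shifted `θ`-variable. -/
noncomputable def vertexKernel (q p c : ℝ) (x : ℝ × ℝ) : ℝ :=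
  if 0 < 2 * x.1 - p then
    (2 * x.1 - p)⁻¹ * Real.exp (-((2 * x.1 - p) + q ^ 2 / (2 * x.1 - p)
      + (x.2 + c) ^ 2 / (2 * x.1 - p)) / 2)
  else 0

lemma vertexKernel_nonneg (q p c : ℝ) (x : ℝ × ℝ) : 0 ≤ vertexKernel q p c x := by
  unfold vertexKernel
  split_ifs with h
  · positivity
  · exact le_rfl

lemma measurable_vertexKernel (q p c : ℝ) : Measurable (vertexKernel q p c) := by
  unfold vertexKernel
  refine Measurable.ite (measurableSet_lt measurable_const (by fun_prop)) ?_ measurable_const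
  fun_prop

/-- A Gaussian integral with an imaginary linear term. -/
lemma integrable_and_integral_gaussian_phase {S : ℝ} (hS : 0 < S) (a c : ℝ) :
    Integrable (fun t : ℝ => Complex.exp (Complex.I * (a * (t + c) / S : ℝ)) *
        (Real.exp (-((t + c) ^ 2 / S) / 2) : ℂ)) ∧
      ∫ t : ℝ, Complex.exp (Complex.I * (a * (t + c) / S : ℝ)) *
        (Real.exp (-((t + c) ^ 2 / S) / 2) : ℂ) =
      ((√(2 * Real.pi) * √S * Real.exp (-(a ^ 2 / S) / 2) : ℝ) : ℂ) := by
  set b : ℂ := ((-(1 / (2 * S)) : ℝ) : ℂ) with hb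
  have hbre : b.re < 0 := by
    rw [hb, Complex.ofReal_re]
    have : 0 < 1 / (2 * S) := by positivity
    linarith
  have hSc : (S : ℂ) ≠ 0 := by exact_mod_cast hS.ne'
  have hfun : ∀ t : ℝ, Complex.exp (Complex.I * (a * (t + c) / S : ℝ)) *
        (Real.exp (-((t + c) ^ 2 / S) / 2) : ℂ) =
      (fun t : ℝ => Complex.exp (b * t ^ 2 + (Complex.I * (a / S : ℝ)) * t + 0)) (t + c) := by
    intro t
    rw [Complex.ofReal_exp, ← Complex.exp_add, hb]
    congr 1
    push_cast
    field_simp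
    ring
  simp_rw [hfun]
  refine ⟨(integrable_cexp_quadratic' hbre _ _).comp_add_right c, ?_⟩
  rw [integral_add_right_eq_self
    (fun t : ℝ => Complex.exp (b * t ^ 2 + (Complex.I * (a / S : ℝ)) * t + 0)) c,
    integral_cexp_quadratic hbre]
  have h1 : (Real.pi / -b : ℂ) = ((2 * Real.pi * S : ℝ) : ℂ) := by
    rw [hb]
    push_cast
    field_simp
  have h2 : (0 - (Complex.I * (a / S : ℝ)) ^ 2 / (4 * b) : ℂ) =
      ((-(a ^ 2 / S) / 2 : ℝ) : ℂ) := by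
    rw [hb]
    push_cast
    rw [mul_pow, Complex.I_sq]
    field_simp
    ring
  rw [h1, h2, ← Complex.ofReal_exp, show (1 / 2 : ℂ) = ((1 / 2 : ℝ) : ℂ) by push_cast; rfl,
    ← Complex.ofReal_cpow (by positivity), ← Real.sqrt_eq_rpow, Real.sqrt_mul (by positivity)]
  push_cast
  ring

/-- The `b`-integral that remains after the Gaussian integration in `t`; here `r = q - a`, where
`a` is the parameter of the phase in `integrable_and_integral_vertexKernel`. -/
lemma integrable_and_integral_vertexMarginal {r : ℝ} (hr : 0 ≤ r) (p : ℝ) :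
    Integrable (fun b : ℝ => if 0 < 2 * b - p then
        (√(2 * b - p))⁻¹ * Real.exp (-((2 * b - p) + r ^ 2 / (2 * b - p)) / 2) else 0) ∧
      ∫ b : ℝ, (if 0 < 2 * b - p then
        (√(2 * b - p))⁻¹ * Real.exp (-((2 * b - p) + r ^ 2 / (2 * b - p)) / 2) else 0) =
      √(2 * Real.pi) / 2 * Real.exp (-r) := by
  obtain ⟨hi, hv⟩ := integrableOn_and_integral_recipInvGauss hr
  rw [← integrable_indicator_iff measurableSet_Ioi] at hi
  rw [← integral_indicator measurableSet_Ioi] at hv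
  set F : ℝ → ℝ := (Set.Ioi (0 : ℝ)).indicator
    (fun S : ℝ => (√S)⁻¹ * Real.exp (-(S + r ^ 2 / S) / 2)) with hF
  have hfun : ∀ b : ℝ, (if 0 < 2 * b - p then
        (√(2 * b - p))⁻¹ * Real.exp (-((2 * b - p) + r ^ 2 / (2 * b - p)) / 2) else 0) =
      F (2 * b - p) := by
    intro b
    simp [hF, Set.indicator_apply]
  simp_rw [hfun]
  refine ⟨(hi.comp_sub_right p).comp_mul_left' two_ne_zero, ?_⟩
  rw [Measure.integral_comp_mul_left (fun y => F (y - p)) 2, integral_sub_right_eq_self F p, hv]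
  rw [abs_of_pos (by norm_num), smul_eq_mul]
  ring

/-- The total mass of the vertex kernel, and its integral against the phase
`e^{a q / S + i a (t + c) / S}`. -/
lemma integrable_and_integral_vertexKernel {q : ℝ} (hq : 0 ≤ q) {a : ℝ} (ha : a ≤ 0) (p c : ℝ) :
    Integrable (fun x : ℝ × ℝ => Complex.exp ((a * q / (2 * x.1 - p) : ℝ) +
        Complex.I * (a * (x.2 + c) / (2 * x.1 - p) : ℝ)) * (vertexKernel q p c x : ℂ)) ∧
      ∫ x : ℝ × ℝ, Complex.exp ((a * q / (2 * x.1 - p) : ℝ) +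
        Complex.I * (a * (x.2 + c) / (2 * x.1 - p) : ℝ)) * (vertexKernel q p c x : ℂ) =
      ((Real.pi * Real.exp (a - q) : ℝ) : ℂ) := by
  have hfun : ∀ (d e b t : ℝ), Complex.exp ((d * e / (2 * b - p) : ℝ) +
        Complex.I * (d * (t + c) / (2 * b - p) : ℝ)) * (vertexKernel e p c (b, t) : ℂ) =
      if 0 < 2 * b - p then (((2 * b - p)⁻¹ * Real.exp (d * e / (2 * b - p)) *
        Real.exp (-((2 * b - p) + e ^ 2 / (2 * b - p)) / 2) : ℝ) : ℂ) *
        (Complex.exp (Complex.I * (d * (t + c) / (2 * b - p) : ℝ)) *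
          (Real.exp (-((t + c) ^ 2 / (2 * b - p)) / 2) : ℂ)) else 0 := by
    intro d e b t
    unfold vertexKernel
    split_ifs with h
    · dsimp only
      rw [show -((2 * b - p) + e ^ 2 / (2 * b - p) + (t + c) ^ 2 / (2 * b - p)) / 2 =
        -((2 * b - p) + e ^ 2 / (2 * b - p)) / 2 + -((t + c) ^ 2 / (2 * b - p)) / 2 by ring,
        Real.exp_add, Complex.exp_add, ← Complex.ofReal_exp (d * e / (2 * b - p))]
      push_cast
      ring
    · simp
  have hinner : ∀ (d e b : ℝ), Integrable (fun t : ℝ => Complex.exp ((d * e / (2 * b - p) : ℝ) +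
        Complex.I * (d * (t + c) / (2 * b - p) : ℝ)) * (vertexKernel e p c (b, t) : ℂ)) ∧
      ∫ t : ℝ, Complex.exp ((d * e / (2 * b - p) : ℝ) +
        Complex.I * (d * (t + c) / (2 * b - p) : ℝ)) * (vertexKernel e p c (b, t) : ℂ) =
      ((√(2 * Real.pi) * (if 0 < 2 * b - p then
        (√(2 * b - p))⁻¹ * Real.exp (-((2 * b - p) + (e - d) ^ 2 / (2 * b - p)) / 2)
          else 0) : ℝ) : ℂ) := by
    intro d e b
    simp_rw [hfun]
    split_ifs with h
    · obtain ⟨h1, h2⟩ := integrable_and_integral_gaussian_phase h d c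
      refine ⟨h1.const_mul _, ?_⟩
      rw [integral_const_mul, h2, ← Complex.ofReal_mul]
      congr 1
      have hs : (2 * b - p)⁻¹ * √(2 * b - p) = (√(2 * b - p))⁻¹ := by
        nth_rw 1 [← Real.mul_self_sqrt h.le]
        have := (Real.sqrt_pos.2 h).ne'
        field_simp
      have he : Real.exp (d * e / (2 * b - p)) *
          Real.exp (-((2 * b - p) + e ^ 2 / (2 * b - p)) / 2) *
          Real.exp (-(d ^ 2 / (2 * b - p)) / 2) =
          Real.exp (-((2 * b - p) + (e - d) ^ 2 / (2 * b - p)) / 2) := by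
        rw [← Real.exp_add, ← Real.exp_add]
        congr 1
        ring
      rw [← he, ← hs]
      ring
    · simp
  have hreal : Integrable (fun x : ℝ × ℝ => (vertexKernel q p c x : ℂ)) := by
    have hm : AEStronglyMeasurable (fun x : ℝ × ℝ => (vertexKernel q p c x : ℂ))
        (volume.prod volume) :=
      (Complex.measurable_ofReal.comp (measurable_vertexKernel q p c)).aestronglyMeasurable
    rw [Measure.volume_eq_prod, integrable_prod_iff hm]
    have h0 : ∀ b, Integrable (fun t : ℝ => (vertexKernel q p c (b, t) : ℂ)) ∧
        ∫ t : ℝ, (vertexKernel q p c (b, t) : ℂ) = ((√(2 * Real.pi) * (if 0 < 2 * b - p then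
        (√(2 * b - p))⁻¹ * Real.exp (-((2 * b - p) + q ^ 2 / (2 * b - p)) / 2)
          else 0) : ℝ) : ℂ) := by
      intro b
      simpa using hinner 0 q b
    refine ⟨Filter.Eventually.of_forall fun b => (h0 b).1, ?_⟩
    refine ((integrable_and_integral_vertexMarginal hq p).1.const_mul √(2 * Real.pi)).congr
      (Filter.Eventually.of_forall fun b => ?_)
    have h1 : ∀ t, ‖(vertexKernel q p c (b, t) : ℂ)‖ = vertexKernel q p c (b, t) := fun t => by
      rw [Complex.norm_real, Real.norm_of_nonneg (vertexKernel_nonneg _ _ _ _)]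
    simp_rw [h1]
    have h2 := (h0 b).2
    rw [integral_complex_ofReal] at h2
    exact (Complex.ofReal_injective h2).symm
  have hint : Integrable (fun x : ℝ × ℝ => Complex.exp ((a * q / (2 * x.1 - p) : ℝ) +
        Complex.I * (a * (x.2 + c) / (2 * x.1 - p) : ℝ)) * (vertexKernel q p c x : ℂ)) := by
    refine hreal.mono (Measurable.aestronglyMeasurable ?_) (Filter.Eventually.of_forall fun x => ?_)
    · have := measurable_vertexKernel q p c
      fun_prop
    · rw [norm_mul, Complex.norm_exp]
      by_cases h : 0 < 2 * x.1 - p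
      · refine mul_le_of_le_one_left (norm_nonneg _) (Real.exp_le_one_iff.2 ?_)
        simp only [Complex.add_re, Complex.ofReal_re, Complex.mul_re, Complex.I_re, Complex.I_im,
          Complex.ofReal_im, zero_mul, one_mul, sub_zero, add_zero]
        exact div_nonpos_of_nonpos_of_nonneg (mul_nonpos_of_nonpos_of_nonneg ha hq) h.le
      · simp [vertexKernel, h]
  refine ⟨hint, ?_⟩
  rw [Measure.volume_eq_prod] at hint ⊢
  rw [integral_prod _ hint]
  simp_rw [fun b => (hinner a q b).2]
  rw [integral_complex_ofReal, integral_const_mul,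
    (integrable_and_integral_vertexMarginal (show 0 ≤ q - a by linarith) p).2]
  congr 1
  have := Real.mul_self_sqrt (show 0 ≤ 2 * Real.pi by positivity)
  rw [neg_sub]
  linear_combination (1 / 2) * Real.exp (a - q) * this

/-! ### Schur complements and positive definite matrices with nonpositive off-diagonal entries -/

section Matrices

variable {ι : Type*} [Fintype ι] [DecidableEq ι]

/-- The bilinear form `⟨u, K⁻¹ v⟩` of the Green's function `K⁻¹`. -/
noncomputable def green (K : Matrix ι ι ℝ) (u v : ι → ℝ) : ℝ := u ⬝ᵥ K⁻¹.mulVec v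

lemma green_add_left (K : Matrix ι ι ℝ) (u u' v : ι → ℝ) :
    green K (u + u') v = green K u v + green K u' v := add_dotProduct _ _ _

lemma green_add_right (K : Matrix ι ι ℝ) (u v v' : ι → ℝ) :
    green K u (v + v') = green K u v + green K u v' := by
  simp [green, Matrix.mulVec_add, dotProduct_add]

lemma green_neg_left (K : Matrix ι ι ℝ) (u v : ι → ℝ) : green K (-u) v = -green K u v :=
  neg_dotProduct _ _

lemma green_neg_right (K : Matrix ι ι ℝ) (u v : ι → ℝ) : green K u (-v) = -green K u v := by
  simp [green, Matrix.mulVec_neg]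

lemma green_comm {K : Matrix ι ι ℝ} (hK : K.IsSymm) (u v : ι → ℝ) :
    green K u v = green K v u := by
  have hKi : K⁻¹.IsSymm := by rw [Matrix.IsSymm, Matrix.transpose_nonsing_inv, hK]
  rw [green, green, Matrix.dotProduct_mulVec, ← Matrix.mulVec_transpose, hKi, dotProduct_comm]

lemma green_eq_of_mulVec_eq {K : Matrix ι ι ℝ} (hK : IsUnit K.det) {u v y : ι → ℝ}
    (h : K.mulVec y = v) : green K u v = u ⬝ᵥ y := by
  rw [green, ← h, Matrix.mulVec_mulVec, Matrix.nonsing_inv_mul _ hK, Matrix.one_mulVec]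

lemma green_submatrix_equiv {κ : Type*} [Fintype κ] [DecidableEq κ] (K : Matrix κ κ ℝ)
    (e : ι ≃ κ) (u v : κ → ℝ) : green (K.submatrix e e) (u ∘ e) (v ∘ e) = green K u v := by
  rw [green, Matrix.inv_submatrix_equiv, Matrix.submatrix_mulVec_equiv, green,
    Function.comp_assoc, Equiv.self_comp_symm, Function.comp_id]
  exact e.sum_comp fun i => u i * K⁻¹.mulVec v i

lemma posDef_submatrix_equiv_iff {ι κ : Type*} (K : Matrix κ κ ℝ)
    (e : ι ≃ κ) : (K.submatrix e e).PosDef ↔ K.PosDef := by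
  refine ⟨fun h => ?_, fun h => h.submatrix e.injective⟩
  have := h.submatrix e.symm.injective
  simpa using this

lemma isUnit_det_of_posDef {K : Matrix ι ι ℝ} (hK : K.PosDef) : IsUnit K.det :=
  hK.det_pos.ne'.isUnit

lemma isSymm_of_posDef {ι : Type*} {K : Matrix ι ι ℝ} (hK : K.PosDef) : K.IsSymm := by
  simpa [Matrix.IsHermitian, Matrix.IsSymm] using hK.isHermitian

lemma mulVec_inv_mulVec {K : Matrix ι ι ℝ} (hK : K.PosDef) (v : ι → ℝ) :
    K.mulVec (K⁻¹.mulVec v) = v := by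
  rw [Matrix.mulVec_mulVec, Matrix.mul_nonsing_inv _ (isUnit_det_of_posDef hK), Matrix.one_mulVec]

lemma mulVec_option {ι : Type*} [Fintype ι] (K : Matrix (Option ι) (Option ι) ℝ)
    (y : Option ι → ℝ) (i : ι) :
    K.mulVec y (some i) = (K.submatrix some some).mulVec (y ∘ some) i +
      K (some i) none * y none := by
  simp [Matrix.mulVec, dotProduct, Fintype.sum_option, add_comm]

lemma mulVec_option_none {ι : Type*} [Fintype ι] {K : Matrix (Option ι) (Option ι) ℝ}
    (hK : K.IsSymm) (y : Option ι → ℝ) :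
    K.mulVec y none = (fun i => K (some i) none) ⬝ᵥ (y ∘ some) + K none none * y none := by
  simp [Matrix.mulVec, dotProduct, Fintype.sum_option, add_comm, fun i => hK.apply none (some i)]

/-- Solving `K y = v` by block elimination of the vertices different from `none`. -/
lemma green_option {K : Matrix (Option ι) (Option ι) ℝ} (hK : K.PosDef)
    (hA : (K.submatrix some some).PosDef) (u v : Option ι → ℝ)
    (hS : K none none - green (K.submatrix some some) (fun i => K (some i) none)
      (fun i => K (some i) none) ≠ 0) :
    green K u v = green (K.submatrix some some) (u ∘ some) (v ∘ some) +
      (u none - green (K.submatrix some some) (fun i => K (some i) none) (u ∘ some)) *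
      (v none - green (K.submatrix some some) (fun i => K (some i) none) (v ∘ some)) /
      (K none none - green (K.submatrix some some) (fun i => K (some i) none)
        (fun i => K (some i) none)) := by
  set A := K.submatrix some some with hAdef
  set r : ι → ℝ := fun i => K (some i) none with hr
  set S := K none none - green A r r with hSdef
  set y₀ : ℝ := (v none - green A r (v ∘ some)) / S with hy₀
  set y : Option ι → ℝ := fun o => o.elim y₀ fun i => A⁻¹.mulVec (v ∘ some - y₀ • r) i with hy
  have hysome : y ∘ some = A⁻¹.mulVec (v ∘ some - y₀ • r) := rfl
  have hgr : ∀ z, z ⬝ᵥ (y ∘ some) = green A z (v ∘ some) - y₀ * green A z r := by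
    intro z
    rw [hysome, Matrix.mulVec_sub, Matrix.mulVec_smul, dotProduct_sub, dotProduct_smul]
    rfl
  have hsol : K.mulVec y = v := by
    ext o
    cases o with
    | none =>
      rw [mulVec_option_none (isSymm_of_posDef hK), hgr, show y none = y₀ from rfl]
      have : y₀ * S = v none - green A r (v ∘ some) := by
        rw [hy₀]
        field_simp
      rw [hSdef] at this
      linarith
    | some i =>
      rw [mulVec_option, hysome, mulVec_inv_mulVec hA, show y none = y₀ from rfl]
      simp [hr]
      ring
  rw [green_eq_of_mulVec_eq (isUnit_det_of_posDef hK) hsol, dotProduct, Fintype.sum_option]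
  have h2 := hgr (u ∘ some)
  rw [dotProduct] at h2
  simp only [Function.comp_apply] at h2
  rw [h2, show y none = y₀ from rfl, green_comm (isSymm_of_posDef hA) r (u ∘ some), hy₀]
  ring

lemma det_option (K : Matrix (Option ι) (Option ι) ℝ) (hK : K.IsSymm)
    (hA : (K.submatrix some some).PosDef) :
    K.det = (K.submatrix some some).det *
      (K none none - green (K.submatrix some some) (fun i => K (some i) none)
        (fun i => K (some i) none)) := by
  set A := K.submatrix some some with hAdef
  have : Invertible A := Matrix.invertibleOfIsUnitDet A (isUnit_det_of_posDef hA)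
  have h := Matrix.det_fromBlocks₁₁ A (Matrix.of fun i (_ : Unit) => K (some i) none)
    (Matrix.of fun (_ : Unit) i => K none (some i)) (Matrix.of fun (_ _ : Unit) => K none none)
  have h2 : Matrix.fromBlocks A (Matrix.of fun i (_ : Unit) => K (some i) none)
    (Matrix.of fun (_ : Unit) i => K none (some i)) (Matrix.of fun (_ _ : Unit) => K none none)
    = K.submatrix (Equiv.optionEquivSumPUnit ι).symm (Equiv.optionEquivSumPUnit ι).symm := by
    ext i j
    rcases i with i | i <;> rcases j with j | j <;> rfl
  rw [h2, Matrix.det_submatrix_equiv_self] at h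
  rw [h, Matrix.det_unique (n := Unit)]
  congr 1
  rw [Matrix.sub_apply, Matrix.of_apply, Matrix.invOf_eq_nonsing_inv, Matrix.mul_assoc]
  congr 1
  rw [Matrix.mul_apply, green, dotProduct]
  refine Finset.sum_congr rfl fun i _ => ?_
  rw [Matrix.of_apply, hK.apply (some i) none]
  rfl

lemma posDef_option_iff {K : Matrix (Option ι) (Option ι) ℝ} (hK : K.IsSymm)
    (hA : (K.submatrix some some).PosDef) :
    K.PosDef ↔ 0 < K none none - green (K.submatrix some some) (fun i => K (some i) none)
        (fun i => K (some i) none) := by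
  constructor
  · intro h
    have h1 := h.det_pos
    rw [det_option K hK hA] at h1
    exact pos_of_mul_pos_right h1 hA.det_pos.le
  · intro hS
    set A := K.submatrix some some with hAdef
    set r : ι → ℝ := fun i => K (some i) none with hr
    refine Matrix.posDef_iff_dotProduct_mulVec.2
      ⟨by simpa [Matrix.IsHermitian, Matrix.IsSymm] using hK, ?_⟩
    intro x hx
    -- completing the square in the block variable
    set z : ι → ℝ := x ∘ some + x none • A⁻¹.mulVec r with hz
    have hAr := mulVec_inv_mulVec hA r
    have hAs : ∀ a b, a ⬝ᵥ A.mulVec b = b ⬝ᵥ A.mulVec a := fun a b => by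
      rw [Matrix.dotProduct_mulVec, ← Matrix.mulVec_transpose, isSymm_of_posDef hA,
        dotProduct_comm]
    have key : star x ⬝ᵥ K.mulVec x = z ⬝ᵥ A.mulVec z + x none ^ 2 *
        (K none none - green A r r) := by
      have h1 : star x ⬝ᵥ K.mulVec x = (x ∘ some) ⬝ᵥ A.mulVec (x ∘ some) +
          2 * x none * (r ⬝ᵥ (x ∘ some)) + K none none * x none ^ 2 := by
        rw [star_trivial, dotProduct, Fintype.sum_option, mulVec_option_none hK]
        simp_rw [mulVec_option, mul_add, Finset.sum_add_distrib]
        have : ∑ i, x (some i) * (K (some i) none * x none) = x none * (r ⬝ᵥ (x ∘ some)) := by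
          rw [dotProduct, Finset.mul_sum]
          refine Finset.sum_congr rfl fun i _ => ?_
          simp [hr]
          ring
        rw [this]
        simp only [dotProduct, Function.comp_apply, hr]
        ring
      rw [h1, hz, Matrix.mulVec_add, Matrix.mulVec_smul, hAr, add_dotProduct, dotProduct_add,
        dotProduct_add, hAs (x none • _), Matrix.mulVec_smul, hAr]
      simp only [smul_dotProduct, dotProduct_smul, smul_eq_mul, green]
      rw [dotProduct_comm r (x ∘ some), dotProduct_comm (A⁻¹.mulVec r) r]
      ring
    rw [key]
    have hz0 : 0 ≤ z ⬝ᵥ A.mulVec z := by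
      simpa using hA.posSemidef.dotProduct_mulVec_nonneg z
    by_cases h0 : x none = 0
    · have hzne : z ≠ 0 := by
        intro h
        apply hx
        rw [hz, h0, zero_smul, add_zero] at h
        ext o
        cases o with
        | none => exact h0
        | some i => exact congrFun h i
      have := hA.dotProduct_mulVec_pos hzne
      rw [star_trivial] at this
      simpa [h0] using this
    · have : 0 < x none ^ 2 := by positivity
      have := mul_pos this hS
      linarith

/-- A positive definite matrix with nonpositive off-diagonal entries has an inverse with
nonnegative entries. -/
lemma inv_mulVec_nonneg {K : Matrix ι ι ℝ} (hK : K.PosDef)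
    (hoff : ∀ i j, i ≠ j → K i j ≤ 0) {v : ι → ℝ} (hv : ∀ i, 0 ≤ v i) (i : ι) :
    0 ≤ K⁻¹.mulVec v i := by
  set y := K⁻¹.mulVec v with hy
  have hKy : K.mulVec y = v := mulVec_inv_mulVec hK v
  set m : ι → ℝ := fun i => max (-y i) 0 with hm
  have hm0 : ∀ i, 0 ≤ m i := fun i => le_max_right _ _
  -- testing `K y = v` against the negative part `m` of `y`
  have h1 : ∀ i j, m i * (K i j * (y j + m j)) ≤ 0 := by
    intro i j
    have hp : 0 ≤ y j + m j := by
      have := le_max_left (-y j) 0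
      simp only [hm]
      linarith
    by_cases hij : i = j
    · subst hij
      have : m i * (y i + m i) = 0 := by
        simp only [hm]
        rcases le_total (-y i) 0 with h | h
        · simp [max_eq_right h]
        · simp [max_eq_left h]
      have h2 : m i * (K i i * (y i + m i)) = K i i * (m i * (y i + m i)) := by ring
      rw [h2, this, mul_zero]
    · exact mul_nonpos_of_nonneg_of_nonpos (hm0 i)
        (mul_nonpos_of_nonpos_of_nonneg (hoff i j hij) hp)
  have h2 : m ⬝ᵥ K.mulVec (y + m) ≤ 0 := by
    simp only [dotProduct, Matrix.mulVec, Finset.mul_sum]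
    exact Finset.sum_nonpos fun i _ => Finset.sum_nonpos fun j _ => h1 i j
  rw [Matrix.mulVec_add, dotProduct_add, hKy] at h2
  have h3 : 0 ≤ m ⬝ᵥ v := Finset.sum_nonneg fun i _ => mul_nonneg (hm0 i) (hv i)
  have h4 : m = 0 := by
    by_contra hne
    have := hK.dotProduct_mulVec_pos hne
    rw [star_trivial] at this
    linarith
  have h5 := congrFun h4 i
  simp only [hm, Pi.zero_apply] at h5
  have := le_max_left (-y i) 0
  linarith

lemma green_nonneg {K : Matrix ι ι ℝ} (hK : K.PosDef) (hoff : ∀ i j, i ≠ j → K i j ≤ 0)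
    {u v : ι → ℝ} (hu : ∀ i, 0 ≤ u i) (hv : ∀ i, 0 ≤ v i) : 0 ≤ green K u v :=
  Finset.sum_nonneg fun i _ => mul_nonneg (hu i) (inv_mulVec_nonneg hK hoff hv i)

end Matrices

/-! ### The law of `(β, θ)` -/

section Density

variable {ι : Type*} [Fintype ι] [DecidableEq ι]

/-- The random Schrödinger operator `H_β = 2β - W` on the vertices different from `δ`. -/
def schrodinger (W : Matrix ι ι ℝ) (β : ι → ℝ) : Matrix ι ι ℝ :=
  Matrix.diagonal (fun i => 2 * β i) - W

open Classical in
/-- The joint density of `(β, θ)` on `{H_β > 0}`, for weights `W` between the vertices different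
from `δ` and weights `η` to `δ`. -/
noncomputable def dens (W : Matrix ι ι ℝ) (η β θ : ι → ℝ) : ℝ :=
  if (schrodinger W β).PosDef then
    (Real.pi⁻¹) ^ Fintype.card ι * Real.exp (-((1 : ι → ℝ) ⬝ᵥ (schrodinger W β).mulVec 1
      + green (schrodinger W β) η η - 2 * (η ⬝ᵥ 1) + green (schrodinger W β) θ θ) / 2)
      / (schrodinger W β).det
  else 0

/-- The measure with density `dens`. -/
noncomputable def law (W : Matrix ι ι ℝ) (η : ι → ℝ) : Measure ((ι → ℝ) × (ι → ℝ)) :=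
  volume.withDensity fun x => ENNReal.ofReal (dens W η x.1 x.2)

/-- The generating function `exp (c + ⟨α, H_β⁻¹ (η + i θ)⟩)` in terms of `(β, θ)`; it is only used
where `H_β` is positive definite, the inverse being a default value at singular `H_β`. -/
noncomputable def genF (c : ℝ) (α : ι → ℝ) (W : Matrix ι ι ℝ) (η : ι → ℝ)
    (x : (ι → ℝ) × (ι → ℝ)) : ℂ :=
  Complex.exp ((c + green (schrodinger W x.1) α η : ℝ) +
    Complex.I * (green (schrodinger W x.1) α x.2 : ℝ))

lemma dens_nonneg (W : Matrix ι ι ℝ) (η β θ : ι → ℝ) : 0 ≤ dens W η β θ := by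
  unfold dens
  split_ifs with h
  · have := h.det_pos
    have := Real.pi_pos
    positivity
  · exact le_rfl

lemma dens_of_not_posDef {W : Matrix ι ι ℝ} {β : ι → ℝ} (h : ¬ (schrodinger W β).PosDef)
    (η θ : ι → ℝ) : dens W η β θ = 0 := if_neg h

lemma schrodinger_isSymm {ι : Type*} [DecidableEq ι] {W : Matrix ι ι ℝ} (hW : W.IsSymm)
    (β : ι → ℝ) : (schrodinger W β).IsSymm := (Matrix.isSymm_diagonal _).sub hW

lemma schrodinger_offDiag {ι : Type*} [DecidableEq ι] {W : Matrix ι ι ℝ}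
    (hW : ∀ i j, 0 ≤ W i j) (β : ι → ℝ) {i j : ι} (hij : i ≠ j) : schrodinger W β i j ≤ 0 := by
  simp [schrodinger, Matrix.diagonal_apply_ne _ hij, hW i j]

lemma schrodinger_submatrix {ι κ : Type*} [DecidableEq ι] [DecidableEq κ]
    (W : Matrix κ κ ℝ) (β : κ → ℝ) {f : ι → κ} (hf : Function.Injective f) :
    (schrodinger W β).submatrix f f = schrodinger (W.submatrix f f) (β ∘ f) := by
  rw [schrodinger, Matrix.submatrix_sub, Pi.sub_apply, Pi.sub_apply,
    Matrix.submatrix_diagonal _ _ hf]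
  rfl

lemma continuous_schrodinger {ι : Type*} [DecidableEq ι] (W : Matrix ι ι ℝ) :
    Continuous (schrodinger W) :=
  (Continuous.matrix_diagonal (A := fun (β : ι → ℝ) i => 2 * β i) (by fun_prop)).sub
    continuous_const

lemma measurableSet_posDef {W : Matrix ι ι ℝ} (hW : W.IsSymm) :
    MeasurableSet {β : ι → ℝ | (schrodinger W β).PosDef} := by
  have h : {β : ι → ℝ | (schrodinger W β).PosDef} =
      (⋂ x : ι → ℝ, {β | 0 ≤ x ⬝ᵥ (schrodinger W β).mulVec x}) ∩
        {β | (schrodinger W β).det = 0}ᶜ := by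
    ext β
    simp only [Set.mem_ofPred_eq, Set.mem_inter_iff, Set.mem_iInter, Set.mem_compl_iff]
    constructor
    · intro h
      exact ⟨fun x => by simpa using h.posSemidef.dotProduct_mulVec_nonneg x, h.det_pos.ne'⟩
    · rintro ⟨h1, h2⟩
      have h3 : (schrodinger W β).PosSemidef := Matrix.PosSemidef.of_dotProduct_mulVec_nonneg
        (by simpa [Matrix.IsHermitian, Matrix.IsSymm] using schrodinger_isSymm hW β)
        (by simpa using h1)
      exact h3.posDef_iff_det_ne_zero.2 h2
  have hc := continuous_schrodinger W
  rw [h]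
  refine (IsClosed.measurableSet ?_).inter (IsClosed.measurableSet ?_).compl
  · exact isClosed_iInter fun x => isClosed_le continuous_const
      (continuous_const.dotProduct (hc.matrix_mulVec continuous_const))
  · exact isClosed_eq hc.matrix_det continuous_const

lemma measurable_matrix_inv {X : Type*} [MeasurableSpace X] {K : X → Matrix ι ι ℝ}
    (hK : ∀ i j, Measurable fun x => K x i j) (i j : ι) : Measurable fun x => (K x)⁻¹ i j := by
  have hdet : ∀ L : X → Matrix ι ι ℝ, (∀ i j, Measurable fun x => L x i j) →
      Measurable fun x => (L x).det := by
    intro L hL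
    simp only [Matrix.det_apply]
    refine Finset.measurable_sum _ fun σ _ => ?_
    exact (Finset.measurable_prod _ fun i _ => hL _ _).const_smul _
  have h : ∀ x, (K x)⁻¹ i j = (K x).det⁻¹ * ((K x).updateRow j (Pi.single i 1)).det := by
    intro x
    rw [Matrix.inv_def, Matrix.smul_apply, smul_eq_mul, Ring.inverse_eq_inv', Matrix.adjugate_apply]
  simp_rw [h]
  refine (hdet K hK).inv.mul (hdet _ fun k l => ?_)
  by_cases hk : k = j
  · subst hk
    simp
  · simpa [Matrix.updateRow_ne hk] using hK k l

lemma measurable_green {X : Type*} [MeasurableSpace X] {K : X → Matrix ι ι ℝ} {u v : X → ι → ℝ}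
    (hK : ∀ i j, Measurable fun x => K x i j) (hu : Measurable u) (hv : Measurable v) :
    Measurable fun x => green (K x) (u x) (v x) := by
  simp only [green, dotProduct, Matrix.mulVec]
  refine Finset.measurable_sum _ fun i _ => (measurable_pi_iff.1 hu i).mul ?_
  exact Finset.measurable_sum _ fun j _ =>
    (measurable_matrix_inv hK i j).mul (measurable_pi_iff.1 hv j)

lemma measurable_schrodinger_fst (W : Matrix ι ι ℝ) (i j : ι) :
    Measurable fun x : (ι → ℝ) × (ι → ℝ) => schrodinger W x.1 i j :=
  (((continuous_schrodinger W).comp continuous_fst).matrix_elem i j).measurable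

lemma measurable_dens {W : Matrix ι ι ℝ} (hW : W.IsSymm) (η : ι → ℝ) :
    Measurable fun x : (ι → ℝ) × (ι → ℝ) => dens W η x.1 x.2 := by
  unfold dens
  refine Measurable.ite ((measurableSet_posDef hW).preimage measurable_fst) ?_ measurable_const
  have h1 := measurable_green (measurable_schrodinger_fst W)
    (measurable_const (a := η)) (measurable_const (a := η))
  have h2 := measurable_green (measurable_schrodinger_fst W) measurable_snd measurable_snd
  have hc : Continuous fun x : (ι → ℝ) × (ι → ℝ) => schrodinger W x.1 :=
    (continuous_schrodinger W).comp continuous_fst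
  have h3 : Measurable fun x : (ι → ℝ) × (ι → ℝ) => (schrodinger W x.1).det :=
    hc.matrix_det.measurable
  have h4 : Measurable fun x : (ι → ℝ) × (ι → ℝ) =>
      (1 : ι → ℝ) ⬝ᵥ (schrodinger W x.1).mulVec 1 :=
    (continuous_const.dotProduct (hc.matrix_mulVec continuous_const)).measurable
  fun_prop

lemma measurable_genF (c : ℝ) (α : ι → ℝ) (W : Matrix ι ι ℝ) (η : ι → ℝ) :
    Measurable (genF c α W η) := by
  have h1 := measurable_green (measurable_schrodinger_fst W)
    (measurable_const (a := α)) (measurable_const (a := η))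
  have h2 := measurable_green (measurable_schrodinger_fst W)
    (measurable_const (a := α)) measurable_snd
  unfold genF
  fun_prop

lemma norm_genF_le_one {c : ℝ} (hc : c ≤ 0) {α η : ι → ℝ} (hα : ∀ i, α i ≤ 0)
    (hη : ∀ i, 0 ≤ η i) {W : Matrix ι ι ℝ} (hW : ∀ i j, 0 ≤ W i j) {x : (ι → ℝ) × (ι → ℝ)}
    (hx : (schrodinger W x.1).PosDef) : ‖genF c α W η x‖ ≤ 1 := by
  rw [genF, Complex.norm_exp, Real.exp_le_one_iff]
  have h1 : 0 ≤ green (schrodinger W x.1) (-α) η :=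
    green_nonneg hx (fun i j hij => schrodinger_offDiag hW _ hij) (by simpa using hα) hη
  rw [green_neg_left] at h1
  simp only [Complex.add_re, Complex.ofReal_re, Complex.mul_re, Complex.I_re, Complex.I_im,
    Complex.ofReal_im, zero_mul, one_mul, sub_zero, add_zero]
  linarith

lemma dens_submatrix_equiv {κ : Type*} [Fintype κ] [DecidableEq κ] (W : Matrix κ κ ℝ)
    (e : ι ≃ κ) (η β θ : κ → ℝ) :
    dens (W.submatrix e e) (η ∘ e) (β ∘ e) (θ ∘ e) = dens W η β θ := by
  have h1 : (1 : ι → ℝ) ⬝ᵥ ((schrodinger W β).submatrix e e).mulVec 1 =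
      (1 : κ → ℝ) ⬝ᵥ (schrodinger W β).mulVec 1 := by
    simp only [dotProduct, Matrix.mulVec, Matrix.submatrix_apply, Pi.one_apply, mul_one, one_mul]
    rw [← e.sum_comp fun i => ∑ j, schrodinger W β i j]
    exact Finset.sum_congr rfl fun i _ => e.sum_comp fun j => schrodinger W β (e i) j
  have h2 : (η ∘ e) ⬝ᵥ (1 : ι → ℝ) = η ⬝ᵥ 1 := by
    simp only [dotProduct, Pi.one_apply, mul_one]
    exact e.sum_comp η
  unfold dens
  rw [← schrodinger_submatrix W β e.injective, h1, h2, green_submatrix_equiv,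
    green_submatrix_equiv, Matrix.det_submatrix_equiv_self, Fintype.card_congr e]
  by_cases h : (schrodinger W β).PosDef
  · rw [if_pos h, if_pos ((posDef_submatrix_equiv_iff _ e).2 h)]
  · rw [if_neg h, if_neg (mt (posDef_submatrix_equiv_iff _ e).1 h)]

lemma genF_submatrix_equiv {κ : Type*} [Fintype κ] [DecidableEq κ] (W : Matrix κ κ ℝ)
    (e : ι ≃ κ) (c : ℝ) (α η β θ : κ → ℝ) :
    genF c (α ∘ e) (W.submatrix e e) (η ∘ e) (β ∘ e, θ ∘ e) = genF c α W η (β, θ) := by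
  unfold genF
  dsimp only
  rw [← schrodinger_submatrix W β e.injective, green_submatrix_equiv, green_submatrix_equiv]

/-- The weights to `δ` after the vertex `none` has been identified with `δ`. -/
def contractEta (W : Matrix (Option ι) (Option ι) ℝ) (η : Option ι → ℝ) : ι → ℝ :=
  η ∘ some + fun i => W (some i) none

lemma schrodinger_option_col {ι : Type*} [DecidableEq ι] (W : Matrix (Option ι) (Option ι) ℝ)
    (β : Option ι → ℝ) : (fun i => schrodinger W β (some i) none) = -fun i => W (some i) none := by
  ext i
  simp [schrodinger]

lemma one_dotProduct_mulVec_option {ι : Type*} [Fintype ι]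
    {K : Matrix (Option ι) (Option ι) ℝ} (hK : K.IsSymm) :
    (1 : Option ι → ℝ) ⬝ᵥ K.mulVec 1 = (1 : ι → ℝ) ⬝ᵥ (K.submatrix some some).mulVec 1 +
      2 * ((fun i => K (some i) none) ⬝ᵥ 1) + K none none := by
  rw [dotProduct, Fintype.sum_option, mulVec_option_none hK]
  simp_rw [mulVec_option]
  simp only [Pi.one_apply, one_mul, mul_one, Pi.one_comp, Finset.sum_add_distrib, dotProduct]
  ring

/-- The density factorizes into the density of the graph with the vertex `none` contracted
to `δ` and a one-vertex factor depending on `(β, θ)` at that vertex. -/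
lemma dens_option {W : Matrix (Option ι) (Option ι) ℝ} (hW : W.IsSymm)
    (η β θ : Option ι → ℝ) :
    let A := schrodinger (W.submatrix some some) (β ∘ some)
    let w : ι → ℝ := fun i => W (some i) none
    dens W η β θ = dens (W.submatrix some some) (contractEta W η) (β ∘ some) (θ ∘ some) *
      (Real.pi⁻¹ * Real.exp (η none + green A w (η ∘ some)) *
        vertexKernel (η none + green A w (η ∘ some)) (W none none + green A w w)
          (green A w (θ ∘ some)) (β none, θ none)) := by
  intro A w
  set K := schrodinger W β with hK
  have hKs : K.IsSymm := schrodinger_isSymm hW β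
  have hsub : K.submatrix some some = A := schrodinger_submatrix W β (Option.some_injective ι)
  have hcol : (fun i => K (some i) none) = -w := schrodinger_option_col W β
  have hnone : K none none = 2 * β none - W none none := by simp [hK, schrodinger]
  by_cases hA : A.PosDef
  · set S : ℝ := 2 * β none - (W none none + green A w w) with hS
    have hSK : K none none - green (K.submatrix some some) (fun i => K (some i) none)
        (fun i => K (some i) none) = S := by
      rw [hcol, hsub, green_neg_left, green_neg_right, hnone, hS]
      ring
    have hiff := posDef_option_iff hKs (hsub ▸ hA)
    rw [hSK] at hiff
    by_cases hSpos : 0 < S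
    · have hKp : K.PosDef := hiff.2 hSpos
      have hg : ∀ v : Option ι → ℝ, green K v v = green A (v ∘ some) (v ∘ some) +
          (v none + green A w (v ∘ some)) ^ 2 / S := by
        intro v
        rw [green_option hKp (hsub ▸ hA) v v (by rw [hSK]; exact hSpos.ne'), hSK, hcol, hsub,
          green_neg_left]
        ring
      have hcontr : green A (contractEta W η) (contractEta W η) =
          green A (η ∘ some) (η ∘ some) + 2 * green A w (η ∘ some) + green A w w := by
        have : contractEta W η = η ∘ some + w := rfl
        rw [this, green_add_left, green_add_right, green_add_right,
          green_comm (isSymm_of_posDef hA) (η ∘ some) w]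
        ring
      have hceta : contractEta W η ⬝ᵥ (1 : ι → ℝ) = (η ∘ some) ⬝ᵥ 1 + w ⬝ᵥ 1 :=
        add_dotProduct _ _ _
      have heta : η ⬝ᵥ (1 : Option ι → ℝ) = (η ∘ some) ⬝ᵥ (1 : ι → ℝ) + η none := by
        simp [dotProduct, Fintype.sum_option, add_comm]
      rw [dens, dens, if_pos hKp, if_pos hA, vertexKernel, if_pos hSpos]
      rw [det_option K hKs (hsub ▸ hA), hSK, hsub, one_dotProduct_mulVec_option hKs, hcol, hsub,
        hnone, hg, hg, hcontr, hceta, heta, neg_dotProduct, Fintype.card_option]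
      change _ = (Real.pi⁻¹ ^ Fintype.card ι * Real.exp _ / A.det) *
        (Real.pi⁻¹ * Real.exp _ * (S⁻¹ * Real.exp (-(S + _ / S + _ / S) / 2)))
      have hb : 2 * β none - W none none = S + green A w w := by rw [hS]; ring
      rw [hb]
      set q := η none + green A w (η ∘ some)
      have hAd := hA.det_pos.ne'
      rw [pow_succ]
      have hexp : ∀ a b c d : ℝ, a = b + c + d →
          Real.exp a = Real.exp b * Real.exp c * Real.exp d :=
        fun a b c d h => by rw [h, Real.exp_add, Real.exp_add]
      rw [hexp _ _ _ _ (?_ : _ = _ + q + -(S + q ^ 2 / S +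
        (θ none + green A w (θ ∘ some)) ^ 2 / S) / 2)]
      rotate_left
      · exact -((1 : ι → ℝ) ⬝ᵥ A.mulVec 1 + (green A (η ∘ some) (η ∘ some) +
          2 * green A w (η ∘ some) + green A w w) - 2 * ((η ∘ some) ⬝ᵥ 1 + w ⬝ᵥ 1) +
          green A (θ ∘ some) (θ ∘ some)) / 2
      · simp only [q]
        ring
      field_simp
      rfl
    · rw [dens_of_not_posDef (fun h => hSpos (hiff.1 h)), vertexKernel, if_neg hSpos]
      simp
  · have h1 : ¬ K.PosDef := fun h => hA (hsub ▸ h.submatrix (Option.some_injective ι))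
    rw [dens_of_not_posDef h1, dens_of_not_posDef hA, zero_mul]

/-- The generating function picks up the phase of `integrable_and_integral_vertexKernel`. -/
lemma genF_option {W : Matrix (Option ι) (Option ι) ℝ} (c : ℝ) (α η β θ : Option ι → ℝ)
    (hK : (schrodinger W β).PosDef) :
    let A := schrodinger (W.submatrix some some) (β ∘ some)
    let w : ι → ℝ := fun i => W (some i) none
    let a := α none + green A w (α ∘ some)
    let p := W none none + green A w w
    genF c α W η (β, θ) =
      genF (c + α none) (α ∘ some) (W.submatrix some some) (contractEta W η)
        (β ∘ some, θ ∘ some) * (Real.exp (-a) : ℂ) *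
      Complex.exp ((a * (η none + green A w (η ∘ some)) / (2 * β none - p) : ℝ) +
        Complex.I * (a * (θ none + green A w (θ ∘ some)) / (2 * β none - p) : ℝ)) := by
  intro A w a p
  set K := schrodinger W β with hKdef
  have hsub : K.submatrix some some = A := schrodinger_submatrix W β (Option.some_injective ι)
  have hA : A.PosDef := hsub ▸ hK.submatrix (Option.some_injective ι)
  have hcol : (fun i => K (some i) none) = -w := schrodinger_option_col W β
  have hnone : K none none = 2 * β none - W none none := by simp [hKdef, schrodinger]
  have hSK : K none none - green (K.submatrix some some) (fun i => K (some i) none)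
      (fun i => K (some i) none) = 2 * β none - p := by
    rw [hcol, hsub, green_neg_left, green_neg_right, hnone]
    ring
  have hSpos : 0 < 2 * β none - p :=
    hSK ▸ (posDef_option_iff (isSymm_of_posDef hK) (hsub ▸ hA)).1 hK
  have hg : ∀ v : Option ι → ℝ, green K α v = green A (α ∘ some) (v ∘ some) +
      a * (v none + green A w (v ∘ some)) / (2 * β none - p) := by
    intro v
    rw [green_option hK (hsub ▸ hA) α v (by rw [hSK]; exact hSpos.ne'), hSK, hcol, hsub,
      green_neg_left, green_neg_left, sub_neg_eq_add, sub_neg_eq_add]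
  have hce : green A (α ∘ some) (contractEta W η) = green A (α ∘ some) (η ∘ some) +
      green A w (α ∘ some) := by
    have : contractEta W η = η ∘ some + w := rfl
    rw [this, green_add_right, green_comm (isSymm_of_posDef hA) (α ∘ some) w]
  unfold genF
  dsimp only
  rw [Complex.ofReal_exp, ← Complex.exp_add, ← Complex.exp_add]
  congr 1
  change (((c + green K α η : ℝ) : ℂ) + Complex.I * (green K α θ : ℝ)) =
    (((c + α none + green A (α ∘ some) (contractEta W η) : ℝ) : ℂ) +
      Complex.I * (green A (α ∘ some) (θ ∘ some) : ℝ)) + _ + _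
  rw [hg, hg, hce]
  have ha : a = α none + green A w (α ∘ some) := rfl
  rw [show c + α none + (green A (α ∘ some) (η ∘ some) + green A w (α ∘ some)) =
    c + a + green A (α ∘ some) (η ∘ some) by rw [ha]; ring]
  push_cast
  ring

end Density

/-! ### Integrating out a vertex -/

section Marginals

/-- Separate the pair of coordinates at the vertex `e none` from those at the other vertices. -/
def splitVertex {ι κ : Type*} (e : Option ι ≃ κ) :
    ((κ → ℝ) × (κ → ℝ)) ≃ᵐ ((ι → ℝ) × (ι → ℝ)) × (ℝ × ℝ) where
  toFun x := ((fun i => x.1 (e (some i)), fun i => x.2 (e (some i))), (x.1 (e none), x.2 (e none)))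
  invFun y := (fun k => (e.symm k).elim y.2.1 y.1.1, fun k => (e.symm k).elim y.2.2 y.1.2)
  left_inv x := by
    ext k
    all_goals
      obtain ⟨o, rfl⟩ := e.surjective k
      cases o <;> simp
  right_inv y := by
    ext <;> simp
  measurable_toFun := by
    dsimp
    fun_prop
  measurable_invFun := by
    dsimp
    refine Measurable.prodMk ?_ ?_ <;>
    · refine measurable_pi_iff.2 fun k => ?_
      obtain ⟨o, rfl⟩ := e.surjective k
      cases o <;> simp <;> fun_prop

lemma measurable_splitVertex_fst {ι κ : Type*} (e : Option ι ≃ κ) :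
    Measurable fun x => (splitVertex e x).1 :=
  measurable_fst.comp (splitVertex e).measurable

lemma measurePreserving_prodProdProdComm {α β γ δ : Type*} [MeasureSpace α] [MeasureSpace β]
    [MeasureSpace γ] [MeasureSpace δ] [SigmaFinite (volume : Measure α)]
    [SigmaFinite (volume : Measure β)] [SigmaFinite (volume : Measure γ)]
    [SigmaFinite (volume : Measure δ)] :
    MeasurePreserving (fun x : (α × β) × (γ × δ) => ((x.1.1, x.2.1), (x.1.2, x.2.2))) := by
  have h1 : MeasurePreserving (MeasurableEquiv.prodAssoc : (α × β) × (γ × δ) ≃ᵐ _) :=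
    measurePreserving_prodAssoc volume volume volume
  have h2 : MeasurePreserving (MeasurableEquiv.prodAssoc : (β × γ) × δ ≃ᵐ _) :=
    measurePreserving_prodAssoc volume volume volume
  have h3 : MeasurePreserving (MeasurableEquiv.prodAssoc : (γ × β) × δ ≃ᵐ _) :=
    measurePreserving_prodAssoc volume volume volume
  have h4 : MeasurePreserving (MeasurableEquiv.prodAssoc : (α × γ) × (β × δ) ≃ᵐ _) :=
    measurePreserving_prodAssoc volume volume volume
  have hs : MeasurePreserving (Prod.swap : β × γ → γ × β) := Measure.measurePreserving_swap
  have h5 : MeasurePreserving (fun x : β × (γ × δ) => (x.2.1, (x.1, x.2.2))) :=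
    h3.comp ((hs.prod (MeasurePreserving.id (volume : Measure δ))).comp (h2.symm _))
  exact (h4.symm _).comp (((MeasurePreserving.id (volume : Measure α)).prod h5).comp h1)

variable {ι κ : Type*} [Fintype ι] [Fintype κ]

lemma measurePreserving_splitVertex (e : Option ι ≃ κ) : MeasurePreserving (splitVertex e) := by
  have h1 : MeasurePreserving (MeasurableEquiv.piOptionEquivProd (fun _ : Option ι => ℝ)).symm :=
    ⟨MeasurableEquiv.measurable _,
      Measure.pi_map_piOptionEquivProd (fun _ : Option ι => (volume : Measure ℝ))⟩
  have h2 := volume_measurePreserving_piCongrLeft (fun _ : κ => ℝ) e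
  have h3 : MeasurePreserving (fun x : κ → ℝ => ((fun i => x (e (some i)), x (e none)))) :=
    (h1.symm _).comp (h2.symm _)
  exact measurePreserving_prodProdProdComm.comp (h3.prod h3)

variable [DecidableEq ι] [DecidableEq κ]

/-- The weights to `δ` after the vertex `e none` has been identified with `δ`. -/
def contractAlong (e : Option ι ≃ κ) (W : Matrix κ κ ℝ) (η : κ → ℝ) : ι → ℝ :=
  fun i => η (e (some i)) + W (e (some i)) (e none)

/-- The weights between the vertices different from `e none`. -/
def restrictAlong (e : Option ι ≃ κ) (W : Matrix κ κ ℝ) : Matrix ι ι ℝ :=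
  W.submatrix (e ∘ some) (e ∘ some)

lemma isSymm_restrictAlong {ι κ : Type*} (e : Option ι ≃ κ) {W : Matrix κ κ ℝ} (hW : W.IsSymm) :
    (restrictAlong e W).IsSymm := hW.submatrix _

/-- The phase-weighted density integrates over the variables at one vertex to the phase-weighted
density of the contracted graph, `α` at that vertex being moved to `δ`. -/
lemma integral_genF_mul_dens_vertex (e : Option ι ≃ κ) {W : Matrix κ κ ℝ} (hW : W.IsSymm)
    (hW0 : ∀ i j, 0 ≤ W i j) {η : κ → ℝ} (hη : ∀ i, 0 ≤ η i) {α : κ → ℝ} (hα : ∀ i, α i ≤ 0)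
    (c : ℝ) (y : (ι → ℝ) × (ι → ℝ)) :
    Integrable (fun z : ℝ × ℝ => genF c α W η ((splitVertex e).symm (y, z)) *
      (dens W η ((splitVertex e).symm (y, z)).1 ((splitVertex e).symm (y, z)).2 : ℂ)) ∧
    ∫ z : ℝ × ℝ, genF c α W η ((splitVertex e).symm (y, z)) *
      (dens W η ((splitVertex e).symm (y, z)).1 ((splitVertex e).symm (y, z)).2 : ℂ) =
    genF (c + α (e none)) (fun i => α (e (some i))) (restrictAlong e W) (contractAlong e W η) y *
      (dens (restrictAlong e W) (contractAlong e W η) y.1 y.2 : ℂ) := by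
  set W' := W.submatrix e e with hW'
  have hWs' : W'.IsSymm := hW.submatrix _
  have hr : restrictAlong e W = W'.submatrix some some := rfl
  have hce : contractAlong e W η = contractEta W' (η ∘ e) := rfl
  have hαe : (fun i => α (e (some i))) = (α ∘ e) ∘ some := rfl
  set A := schrodinger (W'.submatrix some some) y.1 with hA
  set w : ι → ℝ := fun i => W' (some i) none with hw
  set q := η (e none) + green A w ((η ∘ e) ∘ some) with hq
  set a := α (e none) + green A w ((α ∘ e) ∘ some) with ha
  set p := W' none none + green A w w with hp
  set d := green A w y.2 with hd
  set C : ℂ := genF (c + α (e none)) (fun i => α (e (some i))) (restrictAlong e W)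
    (contractAlong e W η) y * (dens (restrictAlong e W) (contractAlong e W η) y.1 y.2 : ℂ) *
    (Real.exp (-a) : ℂ) * ((Real.pi⁻¹ * Real.exp q : ℝ) : ℂ) with hC
  have hfun : ∀ z : ℝ × ℝ, genF c α W η ((splitVertex e).symm (y, z)) *
      (dens W η ((splitVertex e).symm (y, z)).1 ((splitVertex e).symm (y, z)).2 : ℂ) =
      C * (Complex.exp ((a * q / (2 * z.1 - p) : ℝ) +
        Complex.I * (a * (z.2 + d) / (2 * z.1 - p) : ℝ)) * (vertexKernel q p d z : ℂ)) := by
    intro z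
    set x := (splitVertex e).symm (y, z) with hx
    have hxy : splitVertex e x = (y, z) := (splitVertex e).apply_symm_apply _
    have e1 : (x.1 ∘ e) ∘ some = y.1 := congrArg (fun t => t.1.1) hxy
    have e2 : (x.2 ∘ e) ∘ some = y.2 := congrArg (fun t => t.1.2) hxy
    have e3 : (x.1 ∘ e) none = z.1 := congrArg (fun t => t.2.1) hxy
    have e4 : (x.2 ∘ e) none = z.2 := congrArg (fun t => t.2.2) hxy
    rw [← dens_submatrix_equiv W e, ← Prod.mk.eta (p := x), ← genF_submatrix_equiv W e]
    have h1 := dens_option hWs' (η ∘ e) (x.1 ∘ e) (x.2 ∘ e)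
    dsimp only at h1
    rw [e1, e2, e3, e4] at h1
    by_cases hK : (schrodinger W' (x.1 ∘ e)).PosDef
    · have h2 := genF_option c (α ∘ e) (η ∘ e) (x.1 ∘ e) (x.2 ∘ e) hK
      dsimp only at h2
      rw [e1, e2, e3, e4] at h2
      rw [h1, h2, hC, hr, hce, hαe]
      simp only [Function.comp_apply]
      change genF (c + α (e none)) _ _ _ y * (Real.exp (-a) : ℂ) *
        Complex.exp ((a * q / (2 * z.1 - p) : ℝ) +
        Complex.I * (a * (z.2 + d) / (2 * z.1 - p) : ℝ)) *
        ((dens _ _ y.1 y.2 * (Real.pi⁻¹ * Real.exp q * vertexKernel q p d z) : ℝ) : ℂ) = _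
      push_cast
      ring
    · rw [dens_of_not_posDef hK] at h1 ⊢
      change 0 = dens (W'.submatrix some some) (contractEta W' (η ∘ e)) y.1 y.2 *
        (Real.pi⁻¹ * Real.exp q * vertexKernel q p d z) at h1
      have h3 : (dens (restrictAlong e W) (contractAlong e W η) y.1 y.2 : ℂ) *
        ((Real.pi⁻¹ * Real.exp q : ℝ) : ℂ) * (vertexKernel q p d z : ℂ) = 0 := by
        rw [hr, hce]
        exact_mod_cast (by linarith : dens (W'.submatrix some some) (contractEta W' (η ∘ e))
          y.1 y.2 * (Real.pi⁻¹ * Real.exp q) * vertexKernel q p d z = 0)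
      rw [Complex.ofReal_zero, mul_zero, hC]
      linear_combination (-(genF (c + α (e none)) (fun i => α (e (some i))) (restrictAlong e W)
        (contractAlong e W η) y) * (Real.exp (-a) : ℂ) *
        Complex.exp ((a * q / (2 * z.1 - p) : ℝ) +
        Complex.I * (a * (z.2 + d) / (2 * z.1 - p) : ℝ))) * h3
  simp_rw [hfun]
  by_cases hAp : A.PosDef
  · have hoff : ∀ i j, i ≠ j → A i j ≤ 0 := fun i j hij =>
      schrodinger_offDiag (fun _ _ => hW0 _ _) _ hij
    have hq0 : 0 ≤ q := add_nonneg (hη _) (green_nonneg hAp hoff (fun _ => hW0 _ _) fun _ => hη _)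
    have ha0 : a ≤ 0 := by
      have h := green_nonneg hAp hoff (u := w) (v := -((α ∘ e) ∘ some)) (fun _ => hW0 _ _)
        (fun i => by simpa using hα _)
      rw [green_neg_right] at h
      have := hα (e none)
      linarith
    obtain ⟨h1, h2⟩ := integrable_and_integral_vertexKernel hq0 ha0 p d
    refine ⟨h1.const_mul C, ?_⟩
    rw [integral_const_mul, h2, hC]
    have h3 : ((Real.exp (-a) : ℝ) : ℂ) * ((Real.pi⁻¹ * Real.exp q : ℝ) : ℂ) *
        ((Real.pi * Real.exp (a - q) : ℝ) : ℂ) = 1 := by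
      rw [← Complex.ofReal_mul, ← Complex.ofReal_mul, ← Complex.ofReal_one]
      congr 1
      rw [show Real.exp (-a) * (Real.pi⁻¹ * Real.exp q) * (Real.pi * Real.exp (a - q)) =
        (Real.pi⁻¹ * Real.pi) * (Real.exp (-a) * Real.exp q * Real.exp (a - q)) by ring,
        ← Real.exp_add, ← Real.exp_add, inv_mul_cancel₀ Real.pi_ne_zero]
      simp
    linear_combination (genF (c + α (e none)) (fun i => α (e (some i))) (restrictAlong e W)
      (contractAlong e W η) y * (dens (restrictAlong e W) (contractAlong e W η) y.1 y.2 : ℂ)) * h3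
  · have hC0 : C = 0 := by
      rw [hC, hr, dens_of_not_posDef hAp]
      simp
    have hD0 : dens (restrictAlong e W) (contractAlong e W η) y.1 y.2 = 0 :=
      dens_of_not_posDef hAp _ _
    simp [hC0, hD0]

lemma genF_zero (W : Matrix κ κ ℝ) (η : κ → ℝ) (x : (κ → ℝ) × (κ → ℝ)) :
    genF 0 0 W η x = 1 := by
  simp [genF, green]

lemma lintegral_dens_vertex (e : Option ι ≃ κ) {W : Matrix κ κ ℝ} (hW : W.IsSymm)
    (hW0 : ∀ i j, 0 ≤ W i j) {η : κ → ℝ} (hη : ∀ i, 0 ≤ η i) (y : (ι → ℝ) × (ι → ℝ)) :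
    ∫⁻ z : ℝ × ℝ, ENNReal.ofReal
      (dens W η ((splitVertex e).symm (y, z)).1 ((splitVertex e).symm (y, z)).2) =
    ENNReal.ofReal (dens (restrictAlong e W) (contractAlong e W η) y.1 y.2) := by
  obtain ⟨h1, h2⟩ := integral_genF_mul_dens_vertex e hW hW0 hη (α := 0) (fun _ => le_rfl) 0 y
  have h0 : (fun _ : ι => (0 : ℝ)) = 0 := rfl
  simp only [Pi.zero_apply, h0, add_zero, genF_zero, one_mul] at h1 h2
  rw [integral_complex_ofReal] at h2
  have h3 := Complex.ofReal_injective h2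
  rw [← h3, ofReal_integral_eq_lintegral_ofReal ?_ ?_]
  · have := h1.re
    simpa using this
  · exact Filter.Eventually.of_forall fun z => dens_nonneg _ _ _ _

/-- Removing a vertex by contracting it to `δ` is the marginal of the law of `(β, θ)`. -/
lemma law_map_splitVertex (e : Option ι ≃ κ) {W : Matrix κ κ ℝ} (hW : W.IsSymm)
    (hW0 : ∀ i j, 0 ≤ W i j) {η : κ → ℝ} (hη : ∀ i, 0 ≤ η i) :
    (law W η).map (fun x => (splitVertex e x).1) =
      law (restrictAlong e W) (contractAlong e W η) := by
  have hm := measurable_splitVertex_fst e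
  ext s hs
  rw [Measure.map_apply hm hs, law, law, withDensity_apply _ (hm hs), withDensity_apply _ hs,
    ← lintegral_indicator (hm hs), ← lintegral_indicator hs,
    ← (measurePreserving_splitVertex e).symm.lintegral_comp_emb
      (splitVertex e).symm.measurableEmbedding, Measure.volume_eq_prod, lintegral_prod]
  · refine lintegral_congr fun y => ?_
    by_cases hy : y ∈ s
    · rw [Set.indicator_of_mem hy, ← lintegral_dens_vertex e hW hW0 hη y]
      refine (lintegral_congr fun z => ?_)
      rw [Set.indicator_of_mem]
      simpa using hy
    · rw [Set.indicator_of_notMem hy]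
      refine (lintegral_congr fun z => ?_).trans lintegral_zero
      rw [Set.indicator_of_notMem]
      simpa using hy
  · exact ((((measurable_dens hW η).ennreal_ofReal).indicator (hm hs)).comp
      (splitVertex e).symm.measurable).aemeasurable

end Marginals

section TotalMass

variable {κ : Type*} [Fintype κ] [DecidableEq κ]

lemma law_univ_of_isEmpty [IsEmpty κ] (W : Matrix κ κ ℝ) (η : κ → ℝ) :
    law W η Set.univ = 1 := by
  have hd : ∀ x : (κ → ℝ) × (κ → ℝ), ENNReal.ofReal (dens W η x.1 x.2) = 1 := by
    intro x
    have h : (schrodinger W x.1).PosDef := by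
      refine Matrix.posDef_iff_dotProduct_mulVec.2 ⟨Subsingleton.elim _ _, ?_⟩
      intro y hy
      exact absurd (Subsingleton.elim _ _) hy
    rw [dens, if_pos h]
    simp [green, dotProduct]
  rw [law, withDensity_apply _ MeasurableSet.univ, Measure.restrict_univ, lintegral_congr hd,
    lintegral_one, Measure.volume_eq_prod, ← Set.univ_prod_univ, Measure.prod_prod]
  simp [volume_pi]

lemma law_univ_fin : ∀ (n : ℕ) {W : Matrix (Fin n) (Fin n) ℝ} (_ : W.IsSymm)
    (_ : ∀ i j, 0 ≤ W i j) {η : Fin n → ℝ} (_ : ∀ i, 0 ≤ η i), law W η Set.univ = 1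
  | 0, W, _, _, η, _ => law_univ_of_isEmpty W η
  | n + 1, W, hW, hW0, η, hη => by
    have e : Option (Fin n) ≃ Fin (n + 1) := (finSuccEquiv n).symm
    have h := law_map_splitVertex e hW hW0 hη
    have h2 := congrArg (fun μ => μ Set.univ) h
    rw [Measure.map_apply (measurable_splitVertex_fst e) MeasurableSet.univ,
      Set.preimage_univ] at h2
    rw [h2]
    exact law_univ_fin n (isSymm_restrictAlong e hW) (fun _ _ => hW0 _ _)
      (fun _ => add_nonneg (hη _) (hW0 _ _))

/-- The density of `(β, θ)` is normalized. -/
lemma isProbabilityMeasure_law {W : Matrix κ κ ℝ} (hW : W.IsSymm)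
    (hW0 : ∀ i j, 0 ≤ W i j) {η : κ → ℝ} (hη : ∀ i, 0 ≤ η i) :
    IsProbabilityMeasure (law W η) := by
  refine ⟨?_⟩
  rcases isEmpty_or_nonempty κ with h | h
  · exact law_univ_of_isEmpty W η
  · obtain ⟨n, hn⟩ : ∃ n, Fintype.card κ = n + 1 :=
      Nat.exists_eq_succ_of_ne_zero Fintype.card_ne_zero
    have e : Option (Fin n) ≃ κ := (finSuccEquiv n).symm.trans (Fintype.equivFinOfCardEq hn).symm
    have h2 := congrArg (fun μ => μ Set.univ) (law_map_splitVertex e hW hW0 hη)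
    rw [Measure.map_apply (measurable_splitVertex_fst e) MeasurableSet.univ,
      Set.preimage_univ] at h2
    rw [h2]
    exact law_univ_fin n (isSymm_restrictAlong e hW) (fun _ _ => hW0 _ _)
      (fun _ => add_nonneg (hη _) (hW0 _ _))

lemma ae_law_posDef (W : Matrix κ κ ℝ) (hW : W.IsSymm) (η : κ → ℝ) :
    ∀ᵐ x ∂(law W η), (schrodinger W x.1).PosDef := by
  rw [law, ae_withDensity_iff (measurable_dens hW η).ennreal_ofReal]
  refine Filter.Eventually.of_forall fun x hx => ?_
  by_contra h
  exact hx (by rw [dens_of_not_posDef h, ENNReal.ofReal_zero])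

lemma integral_law {W : Matrix κ κ ℝ} (hW : W.IsSymm) (η : κ → ℝ)
    (F : (κ → ℝ) × (κ → ℝ) → ℂ) :
    ∫ x, F x ∂(law W η) = ∫ x, F x * (dens W η x.1 x.2 : ℂ) := by
  rw [law, integral_withDensity_eq_integral_toReal_smul (measurable_dens hW η).ennreal_ofReal
    (Filter.Eventually.of_forall fun _ => ENNReal.ofReal_lt_top)]
  refine integral_congr_ae (Filter.Eventually.of_forall fun x => ?_)
  dsimp only
  rw [ENNReal.toReal_ofReal (dens_nonneg _ _ _ _), Complex.real_smul, mul_comm]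

lemma integrable_mul_dens {W : Matrix κ κ ℝ} (hW : W.IsSymm) {η : κ → ℝ}
    {F : (κ → ℝ) × (κ → ℝ) → ℂ} (hF : Integrable F (law W η)) :
    Integrable (fun x => F x * (dens W η x.1 x.2 : ℂ)) := by
  rw [law, integrable_withDensity_iff_integrable_smul'
    (measurable_dens hW η).ennreal_ofReal
    (Filter.Eventually.of_forall fun _ => ENNReal.ofReal_lt_top)] at hF
  refine hF.congr (Filter.Eventually.of_forall fun x => ?_)
  dsimp only
  rw [ENNReal.toReal_ofReal (dens_nonneg _ _ _ _), Complex.real_smul, mul_comm]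

lemma integrable_mul_genF {W : Matrix κ κ ℝ} (hW : W.IsSymm) (hW0 : ∀ i j, 0 ≤ W i j)
    {η : κ → ℝ} (hη : ∀ i, 0 ≤ η i) {α : κ → ℝ} (hα : ∀ i, α i ≤ 0) {c : ℝ} (hc : c ≤ 0)
    {g : (κ → ℝ) × (κ → ℝ) → ℂ} (hg : Measurable g) {C : ℝ} (hC : ∀ x, ‖g x‖ ≤ C) :
    Integrable (fun x => g x * genF c α W η x) (law W η) := by
  have := isProbabilityMeasure_law hW hW0 hη
  refine Integrable.of_bound (hg.mul (measurable_genF c α W η)).aestronglyMeasurable C ?_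
  filter_upwards [ae_law_posDef W hW η] with x hx
  rw [norm_mul]
  have h1 := norm_genF_le_one hc hα hη hW0 hx
  have h2 := norm_nonneg (g x)
  nlinarith [hC x]

/-- The one-vertex step of the martingale property. -/
lemma integral_genF_splitVertex {ι : Type*} [Fintype ι] [DecidableEq ι] (e : Option ι ≃ κ)
    {W : Matrix κ κ ℝ} (hW : W.IsSymm) (hW0 : ∀ i j, 0 ≤ W i j) {η : κ → ℝ} (hη : ∀ i, 0 ≤ η i)
    {α : κ → ℝ} (hα : ∀ i, α i ≤ 0) {c : ℝ} (hc : c ≤ 0)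
    {g : (ι → ℝ) × (ι → ℝ) → ℂ} (hg : Measurable g) {C : ℝ} (hC : ∀ x, ‖g x‖ ≤ C) :
    ∫ x, g (splitVertex e x).1 * genF c α W η x ∂(law W η) =
      ∫ y, g y * genF (c + α (e none)) (fun i => α (e (some i))) (restrictAlong e W)
        (contractAlong e W η) y ∂(law (restrictAlong e W) (contractAlong e W η)) := by
  have hm := measurable_splitVertex_fst e
  have hi := integrable_mul_dens hW
    (integrable_mul_genF hW hW0 hη hα hc (hg.comp hm) fun x => hC _)
  rw [integral_law hW, integral_law (isSymm_restrictAlong e hW)]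
  have hmp := (measurePreserving_splitVertex e).symm
  have hi2 := (hmp.integrable_comp_emb (splitVertex e).symm.measurableEmbedding).2 hi
  rw [← hmp.integral_comp (splitVertex e).symm.measurableEmbedding]
  rw [Measure.volume_eq_prod] at hi2 ⊢
  refine (integral_prod _ hi2).trans (integral_congr_ae (Filter.Eventually.of_forall fun y => ?_))
  have h := (integral_genF_mul_dens_vertex e hW hW0 hη hα c y).2
  dsimp only [Function.comp_apply]
  rw [mul_assoc, ← h, ← integral_const_mul]
  refine integral_congr_ae (Filter.Eventually.of_forall fun z => ?_)
  dsimp only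
  rw [MeasurableEquiv.apply_symm_apply, mul_assoc]

end TotalMass

/-! ### Consistency of the wired laws -/

section Wired

/-- The weights between the vertices different from `δ`. -/
def innerW {ι : Type*} (G : WeightedGraph (Option ι)) : Matrix ι ι ℝ :=
  Matrix.of fun i j => G.W (some i) (some j)

/-- The weights of the edges to `δ`. -/
def outerW {ι : Type*} (G : WeightedGraph (Option ι)) (i : ι) : ℝ := G.W (some i) none

lemma innerW_isSymm {ι : Type*} (G : WeightedGraph (Option ι)) : (innerW G).IsSymm := by
  ext i j
  exact G.symm _ _

lemma innerW_nonneg {ι : Type*} (G : WeightedGraph (Option ι)) (i j : ι) : 0 ≤ innerW G i j :=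
  G.nonneg _ _

lemma outerW_nonneg {ι : Type*} (G : WeightedGraph (Option ι)) (i : ι) : 0 ≤ outerW G i :=
  G.nonneg _ _

variable {V : Type*} [DecidableEq V]

/-- The law of `(β, θ)` on the finite graph with wired boundary conditions. -/
noncomputable def wiredLaw (G : WeightedGraph V) (S : Finset V) : Measure ((S → ℝ) × (S → ℝ)) :=
  law (innerW (G.wired S)) (outerW (G.wired S))

/-- The generating function of the wired graph in terms of `(β, θ)`. -/
noncomputable def wiredGen (G : WeightedGraph V) (α : V →₀ ℝ) (S : Finset V) :
    (S → ℝ) × (S → ℝ) → ℂ :=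
  genF (wiredParam α S none) (fun i => wiredParam α S (some i)) (innerW (G.wired S))
    (outerW (G.wired S))

/-- Restriction of a configuration `(β, θ)` to a smaller vertex set. -/
def restrictPair {U S : Finset V} (h : U ⊆ S) (x : (S → ℝ) × (S → ℝ)) : (U → ℝ) × (U → ℝ) :=
  (fun i => x.1 ⟨i, h i.2⟩, fun i => x.2 ⟨i, h i.2⟩)

lemma measurable_restrictPair {V : Type*} {U S : Finset V} (h : U ⊆ S) :
    Measurable (restrictPair h) := by
  unfold restrictPair
  fun_prop

lemma isProbabilityMeasure_wiredLaw (G : WeightedGraph V) (S : Finset V) :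
    IsProbabilityMeasure (wiredLaw G S) :=
  isProbabilityMeasure_law (innerW_isSymm _) (innerW_nonneg _) (outerW_nonneg _)

lemma wiredParam_nonpos {α : V →₀ ℝ} (hα : ∀ i, α i ≤ 0) (S : Finset V) (o : Option S) :
    wiredParam α S o ≤ 0 := by
  cases o with
  | none => exact Finset.sum_nonpos fun j _ => hα j
  | some i => exact hα i

lemma wiredParam_insert_none (α : V →₀ ℝ) {S : Finset V} {x : V} (hx : x ∉ S) :
    wiredParam α (insert x S) none + α x = wiredParam α S none := by
  change ∑ j ∈ α.support \ insert x S, α j + α x = ∑ j ∈ α.support \ S, α j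
  rw [Finset.sdiff_insert]
  by_cases h : x ∈ α.support
  · exact Finset.sum_erase_add _ _ (by simpa [hx] using h)
  · rw [Finset.erase_eq_of_notMem (by simp [h]), Finsupp.notMem_support_iff.1 h, add_zero]

/-- The vertices of `insert x S` with `x` singled out. -/
noncomputable def insertEquiv {S : Finset V} {x : V} (hx : x ∉ S) :
    Option S ≃ (insert x S : Finset V) :=
  Equiv.ofBijective
    (fun o => o.elim ⟨x, Finset.mem_insert_self x S⟩
      fun i => ⟨i, Finset.mem_insert_of_mem i.2⟩) <| by
    constructor
    · rintro (_ | i) (_ | j) h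
      · rfl
      · exact absurd (congrArg Subtype.val h) fun h : x = (j : V) => hx (h ▸ j.2)
      · exact absurd (congrArg Subtype.val h) fun h : (i : V) = x => hx (h ▸ i.2)
      · exact congrArg some (Subtype.ext (congrArg (fun t => t.1) h))
    · rintro ⟨y, hy⟩
      rcases Finset.mem_insert.1 hy with rfl | h
      · exact ⟨none, rfl⟩
      · exact ⟨some ⟨y, h⟩, rfl⟩

lemma restrictAlong_insert (G : WeightedGraph V) {S : Finset V} {x : V} (hx : x ∉ S) :
    restrictAlong (insertEquiv hx) (innerW (G.wired (insert x S))) = innerW (G.wired S) := rfl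

lemma contractAlong_insert (G : WeightedGraph V) (hsum : ∀ i, Summable (G.W i)) {S : Finset V}
    {x : V} (hx : x ∉ S) :
    contractAlong (insertEquiv hx) (innerW (G.wired (insert x S)))
      (outerW (G.wired (insert x S))) = outerW (G.wired S) := by
  ext i
  change (∑' j : {j : V // j ∉ insert x S}, G.W i j) + G.W i x = ∑' j : {j : V // j ∉ S}, G.W i j
  have h1 := (hsum i).sum_add_tsum_subtype_compl S
  have h2 := (hsum i).sum_add_tsum_subtype_compl (insert x S)
  rw [Finset.sum_insert hx] at h2
  linarith

lemma wiredLaw_map_insert (G : WeightedGraph V) (hsum : ∀ i, Summable (G.W i)) {S : Finset V}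
    {x : V} (hx : x ∉ S) :
    (wiredLaw G (insert x S)).map (restrictPair (Finset.subset_insert x S)) = wiredLaw G S := by
  have h := law_map_splitVertex (insertEquiv hx) (innerW_isSymm (G.wired (insert x S)))
    (innerW_nonneg _) (outerW_nonneg (G.wired (insert x S)))
  rw [restrictAlong_insert, contractAlong_insert G hsum hx] at h
  exact h

lemma integral_wiredGen_insert (G : WeightedGraph V) (hsum : ∀ i, Summable (G.W i))
    {α : V →₀ ℝ} (hα : ∀ i, α i ≤ 0) {S : Finset V} {x : V} (hx : x ∉ S)
    {g : (S → ℝ) × (S → ℝ) → ℂ} (hg : Measurable g) {C : ℝ} (hC : ∀ y, ‖g y‖ ≤ C) :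
    ∫ y, g (restrictPair (Finset.subset_insert x S) y) * wiredGen G α (insert x S) y
      ∂(wiredLaw G (insert x S)) = ∫ y, g y * wiredGen G α S y ∂(wiredLaw G S) := by
  have h := integral_genF_splitVertex (insertEquiv hx) (innerW_isSymm (G.wired (insert x S)))
    (innerW_nonneg _) (outerW_nonneg (G.wired (insert x S)))
    (α := fun i => wiredParam α (insert x S) (some i)) (fun i => wiredParam_nonpos hα _ _)
    (c := wiredParam α (insert x S) none) (wiredParam_nonpos hα _ _) hg hC
  have h1 : wiredParam α (insert x S) none + wiredParam α (insert x S)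
      (some (insertEquiv hx none)) = wiredParam α S none := wiredParam_insert_none α hx
  rw [restrictAlong_insert, contractAlong_insert G hsum hx, h1] at h
  exact h

/-- The wired laws are consistent. -/
lemma wiredLaw_map_restrictPair (G : WeightedGraph V) (hsum : ∀ i, Summable (G.W i))
    {U S : Finset V} (h : U ⊆ S) :
    (wiredLaw G S).map (restrictPair h) = wiredLaw G U := by
  suffices H : ∀ T S : Finset V, S = U ∪ T → ∀ h : U ⊆ S,
      (wiredLaw G S).map (restrictPair h) = wiredLaw G U from
    H S S (Finset.union_eq_right.2 h).symm h
  intro T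
  induction T using Finset.induction_on with
  | empty =>
    intro S hS h
    rw [Finset.union_empty] at hS
    subst hS
    exact Measure.map_id
  | insert x T _ ih =>
    intro S hS h
    rw [Finset.union_insert] at hS
    by_cases hx : x ∈ U ∪ T
    · exact ih S (hS.trans (Finset.insert_eq_of_mem hx)) h
    · subst hS
      rw [← ih (U ∪ T) rfl Finset.subset_union_left, ← wiredLaw_map_insert G hsum hx,
        Measure.map_map (measurable_restrictPair _) (measurable_restrictPair _)]
      rfl

/-- The martingale property of the generating functions under the wired laws. -/
lemma integral_wiredGen_restrictPair (G : WeightedGraph V) (hsum : ∀ i, Summable (G.W i))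
    {α : V →₀ ℝ} (hα : ∀ i, α i ≤ 0) {U S : Finset V} (h : U ⊆ S)
    {g : (U → ℝ) × (U → ℝ) → ℂ} (hg : Measurable g) {C : ℝ} (hC : ∀ y, ‖g y‖ ≤ C) :
    ∫ y, g (restrictPair h y) * wiredGen G α S y ∂(wiredLaw G S) =
      ∫ y, g y * wiredGen G α U y ∂(wiredLaw G U) := by
  suffices H : ∀ T S : Finset V, S = U ∪ T → ∀ h : U ⊆ S,
      ∫ y, g (restrictPair h y) * wiredGen G α S y ∂(wiredLaw G S) =
        ∫ y, g y * wiredGen G α U y ∂(wiredLaw G U) from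
    H S S (Finset.union_eq_right.2 h).symm h
  intro T
  induction T using Finset.induction_on with
  | empty =>
    intro S hS h
    rw [Finset.union_empty] at hS
    subst hS
    rfl
  | insert x T _ ih =>
    intro S hS h
    rw [Finset.union_insert] at hS
    by_cases hx : x ∈ U ∪ T
    · exact ih S (hS.trans (Finset.insert_eq_of_mem hx)) h
    · subst hS
      rw [← ih (U ∪ T) rfl Finset.subset_union_left]
      exact integral_wiredGen_insert G hsum hα hx
        (hg.comp (measurable_restrictPair Finset.subset_union_left)) fun y => hC _

end Wired

/-! ### The bijection between `u` and `β` -/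

section ChangeOfVariables

lemma sum_edgeFinset_eq_half {κ : Type*} [Fintype κ] [DecidableEq κ] (Γ : SimpleGraph κ)
    [DecidableRel Γ.Adj] [Fintype Γ.edgeSet] (f : Sym2 κ → ℝ) :
    ∑ e ∈ Γ.edgeFinset, f e = (1 / 2) * ∑ i, ∑ j, if Γ.Adj i j then f s(i, j) else 0 := by
  have h1 : ∑ i, ∑ j, (if Γ.Adj i j then f s(i, j) else 0) =
      ∑ p ∈ Finset.univ.filter (fun p : κ × κ => Γ.Adj p.1 p.2), f s(p.1, p.2) := by
    rw [Finset.sum_filter, ← Finset.univ_product_univ, Finset.sum_product]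
  have h2 : ∀ p ∈ Finset.univ.filter (fun p : κ × κ => Γ.Adj p.1 p.2),
      s(p.1, p.2) ∈ Γ.edgeFinset := by
    intro p hp
    simpa using hp
  rw [h1, ← Finset.sum_fiberwise_of_maps_to h2, Finset.mul_sum]
  refine Finset.sum_congr rfl fun e he => ?_
  induction e with
  | h a b =>
    have hab : Γ.Adj a b := by simpa using he
    have h3 : (Finset.univ.filter (fun p : κ × κ => Γ.Adj p.1 p.2)).filter
        (fun p => s(p.1, p.2) = s(a, b)) = {(a, b), (b, a)} := by
      ext ⟨x, y⟩
      simp only [Finset.mem_filter, Finset.mem_univ, true_and, Sym2.eq_iff, Finset.mem_insert,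
        Finset.mem_singleton, Prod.mk.injEq]
      constructor
      · exact fun h => h.2
      · rintro (⟨rfl, rfl⟩ | ⟨rfl, rfl⟩)
        · exact ⟨hab, Or.inl ⟨rfl, rfl⟩⟩
        · exact ⟨hab.symm, Or.inr ⟨rfl, rfl⟩⟩
    rw [h3, Finset.sum_pair (by simp [hab.ne]), Sym2.eq_swap (a := b)]
    ring

variable {ι : Type*} [Fintype ι] [DecidableEq ι] (G : WeightedGraph (Option ι))

open WeightedGraph

/-- `e^u` on the vertices different from `δ`. -/
noncomputable def expField (u : ι → ℝ) : ι → ℝ := fun i => Real.exp (u i)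

/-- The operator `H_β` for `β = β(u)`. -/
noncomputable def opOfField (u : ι → ℝ) : Matrix ι ι ℝ :=
  schrodinger (innerW G) (G.beta (pin u))

lemma two_mul_beta {ι : Type*} [Fintype ι] (G : WeightedGraph (Option ι)) (u : ι → ℝ) (i : ι) :
    2 * G.beta (pin u) i = (∑ j, innerW G i j * Real.exp (u j - u i)) +
      outerW G i * Real.exp (-u i) := by
  rw [WeightedGraph.beta, Fintype.sum_option]
  simp only [pin, innerW, outerW, Matrix.of_apply, zero_sub]
  ring

lemma schrodinger_mulVec_apply (β y : ι → ℝ) (i : ι) :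
    (schrodinger (innerW G) β).mulVec y i = 2 * β i * y i - ∑ j, innerW G i j * y j := by
  rw [schrodinger, Matrix.sub_mulVec, Pi.sub_apply, Matrix.mulVec_diagonal]
  rfl

lemma opOfField_mulVec_expField (u : ι → ℝ) :
    (opOfField G u).mulVec (expField u) = outerW G := by
  ext i
  rw [opOfField, schrodinger_mulVec_apply, two_mul_beta, add_mul, Finset.sum_mul]
  simp only [expField]
  have h1 : ∀ j, innerW G i j * Real.exp (u j - u i) * Real.exp (u i) =
      innerW G i j * Real.exp (u j) := by
    intro j
    rw [mul_assoc, ← Real.exp_add, sub_add_cancel]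
  have h2 : outerW G i * Real.exp (-u i) * Real.exp (u i) = outerW G i := by
    rw [mul_assoc, ← Real.exp_add, neg_add_cancel, Real.exp_zero, mul_one]
  simp_rw [h1]
  rw [h2]
  ring

/-- `A_{VV}(u) = e^u H_β e^u`. -/
lemma AVV_eq (u : ι → ℝ) :
    G.AVV (pin u) = Matrix.diagonal (expField u) * opOfField G u *
      Matrix.diagonal (expField u) := by
  ext i j
  rw [Matrix.mul_diagonal, Matrix.diagonal_mul, opOfField, schrodinger, Matrix.sub_apply]
  simp only [AVV, A, Matrix.submatrix_apply, Matrix.of_apply, Option.some.injEq, expField]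
  by_cases hij : i = j
  · subst hij
    rw [if_pos rfl, Matrix.diagonal_apply_eq, two_mul_beta, Fintype.sum_option]
    have h0 : innerW G i i = 0 := G.loopless _
    rw [h0, sub_zero, mul_add, add_mul, Finset.mul_sum, Finset.sum_mul]
    simp only [pin, innerW, outerW, Matrix.of_apply, add_zero]
    rw [add_comm]
    congr 1
    · refine Finset.sum_congr rfl fun k _ => ?_
      rw [Real.exp_add, Real.exp_sub]
      have := (Real.exp_pos (u i)).ne'
      field_simp
    · rw [Real.exp_neg]
      have := (Real.exp_pos (u i)).ne'
      field_simp
  · rw [if_neg hij, Matrix.diagonal_apply_ne _ hij]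
    simp only [pin, innerW, Matrix.of_apply, Real.exp_add]
    ring

/-- The quadratic form of `e^u H_β e^u` is the Dirichlet form with conductances
`W i j e^{u i + u j}` and zero boundary value at `δ`. -/
lemma dotProduct_opOfField_mulVec (u y : ι → ℝ) :
    (expField u * y) ⬝ᵥ (opOfField G u).mulVec (expField u * y) =
      (1 / 2) * ∑ i, ∑ j, G.W i j * Real.exp (pin u i + pin u j) * (pin y i - pin y j) ^ 2 := by
  set a : Option ι → Option ι → ℝ := fun i j => G.W i j * Real.exp (pin u i + pin u j) with ha
  have hasymm : ∀ i j, a i j = a j i := fun i j => by simp only [ha]; rw [G.symm, add_comm]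
  have h1 : ∑ i, ∑ j, a i j * (pin y i - pin y j) ^ 2 =
      2 * (∑ i, (∑ j, a i j) * pin y i ^ 2) - 2 * ∑ i, ∑ j, a i j * (pin y i * pin y j) := by
    have e1 : ∀ i j, a i j * (pin y i - pin y j) ^ 2 = a i j * pin y i ^ 2 + a j i * pin y j ^ 2 -
        2 * (a i j * (pin y i * pin y j)) := by
      intro i j
      rw [← hasymm i j]
      ring
    simp_rw [e1, Finset.sum_sub_distrib, Finset.sum_add_distrib]
    rw [Finset.sum_comm (f := fun i j => a j i * pin y j ^ 2)]
    simp_rw [Finset.sum_mul, Finset.mul_sum, ← Finset.sum_add_distrib]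
    congr 1
    refine Finset.sum_congr rfl fun i _ => Finset.sum_congr rfl fun j _ => ?_
    ring
  have h2 : ∀ i, (∑ j, a (some i) j) = 2 * G.beta (pin u) i * Real.exp (u i) ^ 2 := by
    intro i
    have h := congrFun (congrFun (AVV_eq G u) i) i
    rw [Matrix.mul_diagonal, Matrix.diagonal_mul, opOfField, schrodinger, Matrix.sub_apply,
      Matrix.diagonal_apply_eq, show innerW G i i = 0 from G.loopless _] at h
    simp only [AVV, A, Matrix.submatrix_apply, Matrix.of_apply, if_true, expField] at h
    simp only [ha]
    rw [h]
    ring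
  rw [h1]
  simp only [Fintype.sum_option, pin, mul_zero, zero_mul, zero_add, ne_eq,
    OfNat.ofNat_ne_zero, not_false_eq_true, zero_pow, Finset.sum_const_zero]
  rw [dotProduct]
  simp_rw [opOfField, schrodinger_mulVec_apply, Pi.mul_apply, expField]
  rw [← mul_sub, ← mul_assoc, one_div_mul_cancel two_ne_zero, one_mul, ← Finset.sum_sub_distrib]
  refine Finset.sum_congr rfl fun i _ => ?_
  have h2i := h2 i
  rw [Fintype.sum_option] at h2i
  rw [h2i, mul_sub, Finset.mul_sum]
  congr 1
  · ring
  · refine Finset.sum_congr rfl fun j _ => ?_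
    simp only [ha, pin, innerW, Matrix.of_apply, Real.exp_add]
    ring

lemma posDef_opOfField (hG : G.graph.Connected) (u : ι → ℝ) : (opOfField G u).PosDef := by
  have hsymm : (opOfField G u).IsSymm := schrodinger_isSymm (innerW_isSymm G) _
  refine Matrix.posDef_iff_dotProduct_mulVec.2
    ⟨by simpa [Matrix.IsHermitian, Matrix.IsSymm] using hsymm, ?_⟩
  intro x hx
  set y : ι → ℝ := fun i => Real.exp (-u i) * x i with hy
  have hxy : x = expField u * y := by
    ext i
    simp [hy, expField, ← mul_assoc, ← Real.exp_add]
  rw [star_trivial, hxy, dotProduct_opOfField_mulVec]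
  have hnn : ∀ i j, 0 ≤ G.W i j * Real.exp (pin u i + pin u j) * (pin y i - pin y j) ^ 2 :=
    fun i j => mul_nonneg (mul_nonneg (G.nonneg _ _) (Real.exp_pos _).le) (sq_nonneg _)
  have hsum : 0 ≤ ∑ i, ∑ j, G.W i j * Real.exp (pin u i + pin u j) * (pin y i - pin y j) ^ 2 :=
    Finset.sum_nonneg fun i _ => Finset.sum_nonneg fun j _ => hnn i j
  rcases hsum.eq_or_lt with h0 | h0
  · exfalso
    -- a vanishing Dirichlet form forces `y` to be constant along edges
    have hadj : ∀ i j, G.graph.Adj i j → pin y i = pin y j := by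
      intro i j hij
      have h1 := (Finset.sum_eq_zero_iff_of_nonneg fun i _ =>
        Finset.sum_nonneg fun j _ => hnn i j).1 h0.symm i (Finset.mem_univ i)
      have h2 := (Finset.sum_eq_zero_iff_of_nonneg fun j _ => hnn i j).1 h1 j (Finset.mem_univ j)
      have h3 : 0 < G.W i j * Real.exp (pin u i + pin u j) :=
        mul_pos hij (Real.exp_pos _)
      have h4 := (mul_eq_zero.1 h2).resolve_left h3.ne'
      exact sub_eq_zero.1 (pow_eq_zero_iff two_ne_zero |>.1 h4)
    have hreach : ∀ i j, G.graph.Reachable i j → pin y i = pin y j := by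
      rintro i j ⟨p⟩
      induction p with
      | nil => rfl
      | cons h _ ih => exact (hadj _ _ h).trans ih
    apply hx
    rw [hxy]
    ext i
    have h5 : y i = 0 := hreach (some i) none (hG.preconnected _ _)
    simp [h5]
  · linarith

lemma inv_mulVec_outerW_pos (hG : G.graph.Connected) {β : ι → ℝ}
    (hβ : (schrodinger (innerW G) β).PosDef) (i : ι) :
    0 < (schrodinger (innerW G) β)⁻¹.mulVec (outerW G) i := by
  set y := (schrodinger (innerW G) β)⁻¹.mulVec (outerW G) with hy
  have hKy : (schrodinger (innerW G) β).mulVec y = outerW G := mulVec_inv_mulVec hβ _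
  have hnn : ∀ i, 0 ≤ y i := inv_mulVec_nonneg hβ
    (fun i j hij => schrodinger_offDiag (innerW_nonneg G) _ hij) (outerW_nonneg G)
  set z : Option ι → ℝ := fun o => o.elim 1 y with hz
  -- the zero set of `z` is closed under adjacency and does not contain `δ`
  have hstep : ∀ o o', G.graph.Adj o o' → z o = 0 → z o' = 0 := by
    intro o o' hadj ho
    cases o with
    | none => simp [hz] at ho
    | some k =>
      have hk : y k = 0 := ho
      have h1 := congrFun hKy k
      rw [schrodinger_mulVec_apply, hk, mul_zero, zero_sub] at h1
      have hterm : ∀ j, 0 ≤ innerW G k j * y j :=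
        fun j => mul_nonneg (innerW_nonneg G k j) (hnn j)
      have h2 : 0 ≤ ∑ j, innerW G k j * y j := Finset.sum_nonneg fun j _ => hterm j
      have h3 := outerW_nonneg G k
      cases o' with
      | none =>
        have h4 : 0 < outerW G k := hadj
        linarith
      | some j =>
        have h4 : 0 < innerW G k j := hadj
        have h5 : ∑ j, innerW G k j * y j = 0 := by linarith
        have h6 := (Finset.sum_eq_zero_iff_of_nonneg fun j _ => hterm j).1 h5 j (Finset.mem_univ j)
        exact (mul_eq_zero.1 h6).resolve_left h4.ne'
  have hreach : ∀ o o', G.graph.Reachable o o' → z o = 0 → z o' = 0 := by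
    rintro o o' ⟨p⟩
    induction p with
    | nil => exact id
    | cons h _ ih => exact fun h0 => ih (hstep _ _ h h0)
  refine lt_of_le_of_ne (hnn i) fun h => ?_
  have := hreach (some i) none (hG.preconnected _ _) h.symm
  simp [hz] at this

lemma expField_eq (hG : G.graph.Connected) (u : ι → ℝ) :
    (opOfField G u)⁻¹.mulVec (outerW G) = expField u := by
  rw [← opOfField_mulVec_expField G u, Matrix.mulVec_mulVec,
    Matrix.nonsing_inv_mul _ (isUnit_det_of_posDef (posDef_opOfField G hG u)), Matrix.one_mulVec]

lemma beta_injective (hG : G.graph.Connected) :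
    Function.Injective fun u : ι → ℝ => G.beta (pin u) := by
  intro u v h
  have h1 := expField_eq G hG u
  have h2 := expField_eq G hG v
  have h3 : opOfField G u = opOfField G v := congrArg (schrodinger (innerW G)) h
  rw [h3, h2] at h1
  ext i
  exact (Real.exp_injective (congrFun h1 i)).symm

/-- The candidate for `u` with `β(u) = β`: the logarithm of `H_β⁻¹ η`. -/
noncomputable def logGreen (β : ι → ℝ) (i : ι) : ℝ :=
  Real.log ((schrodinger (innerW G) β)⁻¹.mulVec (outerW G) i)

lemma beta_pin_logGreen (hG : G.graph.Connected) {β : ι → ℝ}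
    (hβ : (schrodinger (innerW G) β).PosDef) : G.beta (pin (logGreen G β)) = β := by
  set y := (schrodinger (innerW G) β)⁻¹.mulVec (outerW G) with hy
  have hypos : ∀ i, 0 < y i := inv_mulVec_outerW_pos G hG hβ
  have hexp : ∀ i, Real.exp (logGreen G β i) = y i := fun i => Real.exp_log (hypos i)
  ext i
  have h1 := congrFun (mulVec_inv_mulVec hβ (outerW G)) i
  rw [← hy, schrodinger_mulVec_apply] at h1
  have h2 := two_mul_beta G (logGreen G β) i
  simp_rw [Real.exp_sub, Real.exp_neg, hexp] at h2
  have h3 : ∑ j, innerW G i j * (y j / y i) = (∑ j, innerW G i j * y j) / y i := by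
    rw [Finset.sum_div]
    exact Finset.sum_congr rfl fun j _ => by ring
  rw [h3, ← h1] at h2
  have := (hypos i).ne'
  field_simp at h2
  have h4 : G.beta (pin (logGreen G β)) i * y i = β i * y i := by linarith
  exact mul_right_cancel₀ this h4

lemma range_beta (hG : G.graph.Connected) :
    Set.range (fun u : ι → ℝ => G.beta (pin u)) =
      {β | (schrodinger (innerW G) β).PosDef} := by
  ext β
  constructor
  · rintro ⟨u, rfl⟩
    exact posDef_opOfField G hG u
  · intro h
    exact ⟨logGreen G β, beta_pin_logGreen G hG h⟩

lemma logGreen_beta (hG : G.graph.Connected) (u : ι → ℝ) : logGreen G (G.beta (pin u)) = u := by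
  ext i
  have h := congrFun (expField_eq G hG u) i
  rw [opOfField] at h
  rw [logGreen, h, expField, Real.log_exp]

lemma exists_recoversU (hG : G.graph.Connected) : ∃ f, G.RecoversU f := by
  refine ⟨fun β => pin (logGreen G β), measurable_pi_iff.2 fun o => ?_, fun u hu => ?_⟩
  · cases o with
    | none => exact measurable_const
    | some i =>
      change Measurable fun β => Real.log _
      refine Real.measurable_log.comp ?_
      simp only [Matrix.mulVec, dotProduct]
      refine Finset.measurable_sum _ fun j _ => Measurable.mul_const ?_ _
      exact measurable_matrix_inv
        (fun i j => ((continuous_schrodinger (innerW G)).matrix_elem i j).measurable) i j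
  · have hu' : u = pin fun i => u (some i) := by
      ext o
      cases o with
      | none => exact hu
      | some i => rfl
    dsimp only
    rw [hu', logGreen_beta G hG]

end ChangeOfVariables

/-! ### The law of `(β, θ)` under the `H^{2|2}` measure -/

section SigmaMeasure

variable {ι : Type*} [Fintype ι] [DecidableEq ι] (G : WeightedGraph (Option ι))

open WeightedGraph

/-- The Jacobian matrix of `u ↦ β(u)`. -/
noncomputable def betaJacobian (u : ι → ℝ) : Matrix ι ι ℝ :=
  (-(1 / 2) : ℝ) • (Matrix.diagonal (fun i => Real.exp (-u i)) * opOfField G u *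
    Matrix.diagonal (expField u))

/-- The matrix of the linear map `s ↦ θ(u, s)`. -/
noncomputable def thetaMatrix (u : ι → ℝ) : Matrix ι ι ℝ :=
  opOfField G u * Matrix.diagonal (expField u)

lemma hasFDerivAt_beta (u : ι → ℝ) :
    HasFDerivAt (fun u : ι → ℝ => G.beta (pin u))
      (LinearMap.toContinuousLinearMap (Matrix.toLin' (betaJacobian G u))) u := by
  rw [hasFDerivAt_pi']
  intro i
  have hfun : (fun u : ι → ℝ => G.beta (pin u) i) = fun u =>
      (1 / 2) * ((∑ j, innerW G i j * Real.exp (u j - u i)) +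
      outerW G i * Real.exp (-u i)) := by
    ext u
    rw [← two_mul_beta]
    ring
  rw [hfun]
  have hproj : ∀ j, HasFDerivAt (fun u : ι → ℝ => u j)
      (ContinuousLinearMap.proj (R := ℝ) (φ := fun _ : ι => ℝ) j) u :=
    fun j => hasFDerivAt_apply j u
  have h1 : HasFDerivAt (fun u : ι → ℝ => ∑ j, innerW G i j * Real.exp (u j - u i)) _ u :=
    HasFDerivAt.fun_sum (u := Finset.univ) fun j _ =>
      (((hproj j).sub (hproj i)).exp).const_mul (innerW G i j)
  have h2 := ((hproj i).neg.exp).const_mul (outerW G i)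
  refine ((h1.add h2).const_mul (1 / 2)).congr_fderiv ?_
  ext v
  have h3 : (betaJacobian G u).mulVec v i = -(1 / 2) * (Real.exp (-u i) *
      (opOfField G u).mulVec (fun j => Real.exp (u j) * v j) i) := by
    rw [betaJacobian, Matrix.smul_mulVec, ← Matrix.mulVec_mulVec, ← Matrix.mulVec_mulVec,
      Pi.smul_apply, Matrix.mulVec_diagonal, smul_eq_mul]
    congr 4
    ext j
    rw [Matrix.mulVec_diagonal, expField]
  have h4 : ∀ j, Real.exp (u j - u i) = Real.exp (-u i) * Real.exp (u j) := fun j => by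
    rw [← Real.exp_add]
    congr 1
    ring
  have h5 : Real.exp (-u i) * Real.exp (u i) = 1 := by rw [← Real.exp_add]; simp
  simp only [_root_.smul_apply, _root_.add_apply,
    _root_.sum_apply, _root_.sub_apply, ContinuousLinearMap.proj_apply,
    _root_.neg_apply, smul_eq_mul, ContinuousLinearMap.comp_apply,
    LinearMap.coe_toContinuousLinearMap', Matrix.toLin'_apply, h3, opOfField,
    schrodinger_mulVec_apply, two_mul_beta, h4, Pi.sub_apply, Pi.neg_apply]
  have h6 : ∑ j, innerW G i j * (Real.exp (-u i) * Real.exp (u j) * (v j - v i)) =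
      Real.exp (-u i) * (∑ j, innerW G i j * (Real.exp (u j) * v j)) -
        (∑ j, innerW G i j * (Real.exp (-u i) * Real.exp (u j))) * v i := by
    rw [Finset.mul_sum, Finset.sum_mul, ← Finset.sum_sub_distrib]
    exact Finset.sum_congr rfl fun j _ => by ring
  rw [h6]
  linear_combination (1 / 2) * ((∑ j, innerW G i j * (Real.exp (-u i) * Real.exp (u j))) +
    outerW G i * Real.exp (-u i)) * v i * h5

lemma theta_eq_mulVec (u s : ι → ℝ) :
    G.theta (pin u) (pin s) = (thetaMatrix G u).mulVec s := by
  ext i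
  rw [theta, AVV_eq]
  change Real.exp (-u i) * (_ : Matrix ι ι ℝ).mulVec s i = _
  rw [Matrix.mul_assoc, ← Matrix.mulVec_mulVec, Matrix.mulVec_diagonal, ← mul_assoc, expField,
    ← Real.exp_add, neg_add_cancel, Real.exp_zero, one_mul]
  rfl

lemma prod_expField {ι : Type*} [Fintype ι] (u : ι → ℝ) : ∏ i, expField u i = Real.exp (∑ i, u i) :=
  (Real.exp_sum _ _).symm

lemma det_thetaMatrix (u : ι → ℝ) :
    (thetaMatrix G u).det = (opOfField G u).det * Real.exp (∑ i, u i) := by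
  rw [thetaMatrix, Matrix.det_mul, Matrix.det_diagonal, prod_expField]

lemma abs_det_betaJacobian (hG : G.graph.Connected) (u : ι → ℝ) :
    |(betaJacobian G u).det| = (1 / 2) ^ Fintype.card ι * (opOfField G u).det := by
  have h : (∏ i, Real.exp (-u i)) * Real.exp (∑ i, u i) = 1 := by
    rw [← Real.exp_sum, ← Real.exp_add, Finset.sum_neg_distrib, neg_add_cancel, Real.exp_zero]
  rw [betaJacobian, Matrix.det_smul, Matrix.det_mul, Matrix.det_mul, Matrix.det_diagonal,
    Matrix.det_diagonal, prod_expField, mul_right_comm, h, one_mul, abs_mul, abs_pow,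
    abs_of_pos (posDef_opOfField G hG u).det_pos]
  norm_num

lemma dotProduct_A_pin (u s : ι → ℝ) :
    pin s ⬝ᵥ (G.A (pin u)).mulVec (pin s) =
      (expField u * s) ⬝ᵥ (opOfField G u).mulVec (expField u * s) := by
  have h1 : pin s ⬝ᵥ (G.A (pin u)).mulVec (pin s) = s ⬝ᵥ (G.AVV (pin u)).mulVec s := by
    simp only [dotProduct, Matrix.mulVec, Fintype.sum_option, pin, zero_mul, mul_zero, zero_add]
    rfl
  have h2 : (Matrix.diagonal (expField u)).mulVec s = expField u * s := by
    ext j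
    rw [Matrix.mulVec_diagonal]
    rfl
  rw [h1, AVV_eq, Matrix.mul_assoc, ← Matrix.mulVec_mulVec, ← Matrix.mulVec_mulVec, h2]
  simp only [dotProduct, Matrix.mulVec_diagonal, Pi.mul_apply]
  exact Finset.sum_congr rfl fun i _ => by ring

lemma green_theta (hG : G.graph.Connected) (u s : ι → ℝ) :
    green (opOfField G u) (G.theta (pin u) (pin s)) (G.theta (pin u) (pin s)) =
      pin s ⬝ᵥ (G.A (pin u)).mulVec (pin s) := by
  have h : G.theta (pin u) (pin s) = (opOfField G u).mulVec (expField u * s) := by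
    rw [theta_eq_mulVec, thetaMatrix, ← Matrix.mulVec_mulVec]
    congr 1
    ext j
    rw [Matrix.mulVec_diagonal]
    rfl
  rw [green_eq_of_mulVec_eq (isUnit_det_of_posDef (posDef_opOfField G hG u)) h.symm, h,
    dotProduct_A_pin, dotProduct_comm]

lemma det_AVV (u : ι → ℝ) :
    (G.AVV (pin u)).det = (opOfField G u).det * Real.exp (∑ i, u i) ^ 2 := by
  rw [AVV_eq, Matrix.det_mul, Matrix.det_mul, Matrix.det_diagonal, prod_expField]
  ring

/-- The edge energy is the `θ`-free part of the exponent of `dens`. -/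
lemma two_mul_sum_edgeEnergy [Fintype G.graph.edgeSet] (hG : G.graph.Connected) (u : ι → ℝ) :
    2 * ∑ e ∈ G.graph.edgeFinset, G.edgeEnergy (pin u) e =
      (1 : ι → ℝ) ⬝ᵥ (opOfField G u).mulVec 1 +
        green (opOfField G u) (outerW G) (outerW G) - 2 * (outerW G ⬝ᵥ 1) := by
  classical
  have h1 : ∑ e ∈ G.graph.edgeFinset, G.edgeEnergy (pin u) e = (1 / 2) * ∑ i, ∑ j,
      G.W i j * (Real.cosh (pin u i - pin u j) - 1) := by
    rw [sum_edgeFinset_eq_half]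
    congr 1
    refine Finset.sum_congr rfl fun i _ => Finset.sum_congr rfl fun j _ => ?_
    split_ifs with h
    · rfl
    · have h0 : G.W i j = 0 := le_antisymm (not_lt.1 h) (G.nonneg i j)
      rw [h0, zero_mul]
  have h2 : ∀ i, ∑ j, innerW G i j * Real.exp (u j - u i) =
      2 * G.beta (pin u) i - outerW G i * Real.exp (-u i) := fun i => by
    rw [two_mul_beta]
    ring
  have h3 : green (opOfField G u) (outerW G) (outerW G) = ∑ i, outerW G i * Real.exp (u i) := by
    rw [green, expField_eq G hG]
    rfl
  have h4 : (1 : ι → ℝ) ⬝ᵥ (opOfField G u).mulVec 1 =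
      ∑ i, (2 * G.beta (pin u) i - ∑ j, innerW G i j) := by
    simp only [dotProduct, Pi.one_apply, one_mul, opOfField, schrodinger_mulVec_apply, mul_one]
  have hc : ∀ i j : ι, innerW G i j * (Real.cosh (u i - u j) - 1) =
      (1 / 2) * (innerW G i j * Real.exp (u j - u i)) +
      (1 / 2) * (innerW G j i * Real.exp (u i - u j)) - innerW G i j := by
    intro i j
    rw [(innerW_isSymm G).apply i j, Real.cosh_eq, neg_sub]
    ring
  have hd : ∀ i : ι, outerW G i * (Real.cosh (u i) - 1) =
      (1 / 2) * (outerW G i * Real.exp (u i)) + (1 / 2) * (outerW G i * Real.exp (-u i)) -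
        outerW G i := by
    intro i
    rw [Real.cosh_eq]
    ring
  have h5 : ∑ i, ∑ j, G.W i j * (Real.cosh (pin u i - pin u j) - 1) =
      (∑ i, ∑ j, innerW G i j * (Real.cosh (u i - u j) - 1)) +
        2 * ∑ i, outerW G i * (Real.cosh (u i) - 1) := by
    have e1 : ∀ i : ι, G.W none (some i) * (Real.cosh (0 - u i) - 1) =
        outerW G i * (Real.cosh (u i) - 1) := fun i => by
      rw [G.symm, zero_sub, Real.cosh_neg]
      rfl
    simp only [Fintype.sum_option, pin, e1, G.loopless, zero_mul, zero_add, sub_zero,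
      Finset.sum_add_distrib]
    change ∑ i, outerW G i * (Real.cosh (u i) - 1) + (∑ i, outerW G i * (Real.cosh (u i) - 1) +
      ∑ i, ∑ j, innerW G i j * (Real.cosh (u i - u j) - 1)) = _
    ring
  rw [h1, h5, h3, h4]
  simp_rw [hc, hd, Finset.sum_sub_distrib, Finset.sum_add_distrib]
  rw [Finset.sum_comm (f := fun i j => (1 / 2) * (innerW G j i * Real.exp (u i - u j)))]
  simp_rw [← Finset.mul_sum, h2, Finset.sum_sub_distrib]
  simp only [dotProduct, Pi.one_apply, mul_one, ← Finset.mul_sum]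
  ring

/-- The density of `sigmaMeasure` is the density of the law of `(β, θ)` times the Jacobians of
`u ↦ β` and of `s ↦ θ`. -/
lemma rho_mul_eq (hG : G.graph.Connected) (u s : ι → ℝ) :
    G.rho (pin u) (pin s) * ∏ i, (Real.exp (-u i) / (2 * Real.pi)) =
      |(betaJacobian G u).det| * (|(thetaMatrix G u).det| *
        dens (innerW G) (outerW G) (G.beta (pin u)) (G.theta (pin u) (pin s))) := by
  classical
  have hpd := posDef_opOfField G hG u
  have hdet := hpd.det_pos
  have hE := Real.exp_pos (∑ i, u i)
  rw [abs_det_betaJacobian G hG, det_thetaMatrix, abs_of_pos (mul_pos hdet hE), dens,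
    if_pos (show (schrodinger (innerW G) (G.beta (pin u))).PosDef from hpd)]
  change _ = _ * (_ * ((Real.pi⁻¹) ^ Fintype.card ι *
    Real.exp (-((1 : ι → ℝ) ⬝ᵥ (opOfField G u).mulVec 1 + green (opOfField G u) (outerW G)
      (outerW G) - 2 * (outerW G ⬝ᵥ 1) + green (opOfField G u) (G.theta (pin u) (pin s))
      (G.theta (pin u) (pin s))) / 2) / (opOfField G u).det))
  rw [rho, det_AVV, ← Real.exp_sum, Finset.sum_neg_distrib, green_theta G hG,
    ← two_mul_sum_edgeEnergy G hG, Finset.prod_div_distrib, ← Real.exp_sum, Finset.sum_neg_distrib,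
    Finset.prod_const, Finset.card_univ, Real.exp_neg (∑ i, u i)]
  set E := ∑ e ∈ G.graph.edgeFinset, G.edgeEnergy (pin u) e
  set Q := pin s ⬝ᵥ (G.A (pin u)).mulVec (pin s)
  rw [show -(2 * E + Q) / 2 = -(1 / 2) * Q + -E by ring, Real.exp_add, mul_pow, inv_pow, div_pow,
    one_pow]
  have hpi := Real.pi_pos
  field_simp

lemma continuous_pin {ι : Type*} (o : Option ι) : Continuous fun x : ι → ℝ => pin x o := by
  cases o with
  | none => exact continuous_const
  | some i => exact continuous_apply i

lemma continuous_beta {ι : Type*} [Fintype ι] (G : WeightedGraph (Option ι)) :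
    Continuous fun u : ι → ℝ => G.beta (pin u) := by
  have := continuous_pin (ι := ι)
  unfold WeightedGraph.beta
  fun_prop

lemma continuous_opOfField : Continuous (opOfField G) :=
  (continuous_schrodinger _).comp (continuous_beta G)

lemma continuous_thetaMatrix : Continuous (thetaMatrix G) :=
  (continuous_opOfField G).matrix_mul
    (Continuous.matrix_diagonal (A := expField) (by unfold expField; fun_prop))

lemma measurable_betaTheta : Measurable G.betaTheta := by
  have h : G.betaTheta = fun x => (G.beta (pin x.1), (thetaMatrix G x.1).mulVec x.2) := by
    ext1 x
    rw [betaTheta, theta_eq_mulVec]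
  rw [h]
  exact (((continuous_beta G).comp continuous_fst).prodMk
    (((continuous_thetaMatrix G).comp continuous_fst).matrix_mulVec continuous_snd)).measurable

lemma continuous_betaJacobian : Continuous (betaJacobian G) := by
  refine Continuous.const_smul (g := fun u => Matrix.diagonal (fun i => Real.exp (-u i)) *
    opOfField G u * Matrix.diagonal (expField u)) (Continuous.matrix_mul (Continuous.matrix_mul ?_
    (continuous_opOfField G)) ?_) (-(1 / 2) : ℝ)
  · exact Continuous.matrix_diagonal (A := fun (u : ι → ℝ) i => Real.exp (-u i)) (by fun_prop)
  · exact Continuous.matrix_diagonal (A := expField) (by unfold expField; fun_prop)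

lemma lintegral_comp_mulVec {M : Matrix ι ι ℝ} (hM : M.det ≠ 0) {F : (ι → ℝ) → ENNReal}
    (hF : Measurable F) :
    ∫⁻ s, ENNReal.ofReal |M.det| * F (M.mulVec s) = ∫⁻ t, F t := by
  have h := Real.map_matrix_volume_pi_eq_smul_volume_pi hM
  have hm : Measurable (Matrix.toLin' M) :=
    (LinearMap.continuous_of_finiteDimensional _).measurable
  have h2 : ∫⁻ s, F (M.mulVec s) = ENNReal.ofReal |(M.det)⁻¹| * ∫⁻ t, F t := by
    have h3 : ∫⁻ s, F (Matrix.toLin' M s) = ∫⁻ t, F t ∂(Measure.map (Matrix.toLin' M) volume) :=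
      (lintegral_map hF hm).symm
    simp only [Matrix.toLin'_apply] at h3
    rw [h3, h, lintegral_smul_measure, smul_eq_mul]
  have hFm : Measurable fun s => F (M.mulVec s) := by
    have := hF.comp hm
    exact this
  rw [lintegral_const_mul _ hFm, h2, ← mul_assoc, ← ENNReal.ofReal_mul (abs_nonneg _), ← abs_mul,
    mul_inv_cancel₀ hM, abs_one, ENNReal.ofReal_one, one_mul]

/-- The law of `(β, θ)` under the `H^{2|2}` measure has density `dens`. -/
lemma map_betaTheta_sigmaMeasure (hG : G.graph.Connected) :
    G.sigmaMeasure.map G.betaTheta = law (innerW G) (outerW G) := by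
  ext T hT
  set D : (ι → ℝ) × (ι → ℝ) → ENNReal := T.indicator fun x =>
    ENNReal.ofReal (dens (innerW G) (outerW G) x.1 x.2) with hD
  have hDm : Measurable D := (measurable_dens (innerW_isSymm G) _).ennreal_ofReal.indicator hT
  have hbt := measurable_betaTheta G
  rw [Measure.map_apply hbt hT, sigmaMeasure, withDensity_apply _ (hbt hT), law,
    withDensity_apply _ hT, ← lintegral_indicator (hbt hT), ← lintegral_indicator hT]
  have h1 : ∀ x : (ι → ℝ) × (ι → ℝ), (G.betaTheta ⁻¹' T).indicator (fun x => ENNReal.ofReal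
      (G.rho (pin x.1) (pin x.2) * ∏ i, (Real.exp (-x.1 i) / (2 * Real.pi)))) x =
      ENNReal.ofReal |(betaJacobian G x.1).det| * (ENNReal.ofReal |(thetaMatrix G x.1).det| *
        D (G.beta (pin x.1), (thetaMatrix G x.1).mulVec x.2)) := by
    intro x
    rw [← theta_eq_mulVec]
    by_cases hx : G.betaTheta x ∈ T
    · rw [Set.indicator_of_mem (show x ∈ G.betaTheta ⁻¹' T from hx), hD,
        Set.indicator_of_mem (show (G.beta (pin x.1), G.theta (pin x.1) (pin x.2)) ∈ T from hx),
        rho_mul_eq G hG, ENNReal.ofReal_mul (abs_nonneg _), ENNReal.ofReal_mul (abs_nonneg _)]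
    · rw [Set.indicator_of_notMem (show x ∉ G.betaTheta ⁻¹' T from hx), hD,
        Set.indicator_of_notMem (show (G.beta (pin x.1), G.theta (pin x.1) (pin x.2)) ∉ T from hx),
        mul_zero, mul_zero]
  simp_rw [h1]
  have hm1 : Measurable fun u => ENNReal.ofReal |(betaJacobian G u).det| :=
    (continuous_betaJacobian G).matrix_det.abs.measurable.ennreal_ofReal
  have hm2 : Measurable fun u => ENNReal.ofReal |(thetaMatrix G u).det| :=
    (continuous_thetaMatrix G).matrix_det.abs.measurable.ennreal_ofReal
  have hm3 : Measurable fun x : (ι → ℝ) × (ι → ℝ) =>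
      (G.beta (pin x.1), (thetaMatrix G x.1).mulVec x.2) :=
    (((continuous_beta G).comp continuous_fst).prodMk
      (((continuous_thetaMatrix G).comp continuous_fst).matrix_mulVec continuous_snd)).measurable
  have hm4 : Measurable fun x : (ι → ℝ) × (ι → ℝ) => ENNReal.ofReal |(betaJacobian G x.1).det| *
      (ENNReal.ofReal |(thetaMatrix G x.1).det| *
        D (G.beta (pin x.1), (thetaMatrix G x.1).mulVec x.2)) :=
    (hm1.comp measurable_fst).mul ((hm2.comp measurable_fst).mul (hDm.comp hm3))
  rw [Measure.volume_eq_prod, lintegral_prod _ hm4.aemeasurable]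
  change _ = ∫⁻ x, D x ∂_
  rw [lintegral_prod _ hDm.aemeasurable]
  have h2 : ∀ u : ι → ℝ, ∫⁻ s, ENNReal.ofReal |(betaJacobian G u).det| *
      (ENNReal.ofReal |(thetaMatrix G u).det| * D (G.beta (pin u), (thetaMatrix G u).mulVec s)) =
      ENNReal.ofReal |(betaJacobian G u).det| * ∫⁻ t, D (G.beta (pin u), t) := by
    intro u
    have hdet : (thetaMatrix G u).det ≠ 0 := by
      rw [det_thetaMatrix]
      exact (mul_pos (posDef_opOfField G hG u).det_pos (Real.exp_pos _)).ne'
    have hDu : Measurable fun t => D (G.beta (pin u), t) := hDm.comp measurable_prodMk_left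
    rw [lintegral_const_mul' _ _ ENNReal.ofReal_ne_top, lintegral_comp_mulVec hdet hDu]
  simp only [h2]
  have h3 := lintegral_image_eq_lintegral_abs_det_fderiv_mul (volume : Measure (ι → ℝ))
    MeasurableSet.univ (fun u _ => (hasFDerivAt_beta G u).hasFDerivWithinAt)
    (beta_injective G hG).injOn (fun b => ∫⁻ t, D (b, t))
  rw [Set.image_univ, range_beta G hG, Measure.restrict_univ] at h3
  simp only [ContinuousLinearMap.det, LinearMap.coe_toContinuousLinearMap, LinearMap.det_toLin']
    at h3
  rw [← h3, ← lintegral_indicator (measurableSet_posDef (innerW_isSymm G))]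
  refine lintegral_congr fun b => ?_
  by_cases hb : (schrodinger (innerW G) b).PosDef
  · rw [Set.indicator_of_mem (show b ∈ {β | (schrodinger (innerW G) β).PosDef} from hb)]
  · rw [Set.indicator_of_notMem (show b ∉ {β | (schrodinger (innerW G) β).PosDef} from hb)]
    have h4 : ∀ t, D (b, t) = 0 := by
      intro t
      rw [hD, Set.indicator_apply_eq_zero]
      intro _
      rw [dens_of_not_posDef hb, ENNReal.ofReal_zero]
    simp [h4]

end SigmaMeasure

/-! ### Inverse limits of probability measures -/

section InverseLimit

/-- A sequence of standard Borel probability spaces with measure-preserving connecting maps has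
an inverse limit.  It is the law of the Markov chain whose transition kernels are the regular
conditional laws of the next coordinate given its image under the connecting map. -/
lemma exists_inverseLimit {E : ℕ → Type*} [∀ n, MeasurableSpace (E n)]
    [∀ n, StandardBorelSpace (E n)] [∀ n, Nonempty (E n)] (ν : ∀ n, Measure (E n))
    [∀ n, IsProbabilityMeasure (ν n)] (r : ∀ n, E (n + 1) → E n) (hr : ∀ n, Measurable (r n))
    (hν : ∀ n, (ν (n + 1)).map (r n) = ν n) :
    ∃ Q : Measure (∀ n, E n), IsProbabilityMeasure Q ∧ (∀ n, Q.map (fun x => x n) = ν n) ∧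
      ∀ᵐ x ∂Q, ∀ n, r n (x (n + 1)) = x n := by
  let ev : ∀ n, ((i : Finset.Iic n) → E i) → E n := fun n x => x ⟨n, by simp⟩
  have hev : ∀ n, Measurable (ev n) := fun n => measurable_pi_apply _
  let κ : ∀ n, Kernel ((i : Finset.Iic n) → E i) (E (n + 1)) := fun n =>
    (condDistrib id (r n) (ν (n + 1))).comap (ev n) (hev n)
  set Q := Kernel.trajMeasure (ν 0) κ with hQ
  have hev' : ∀ n, Measurable fun x : ∀ n, E n => x n := fun n => measurable_pi_apply n
  have h0 : Q.map (fun x => x 0) = ν 0 := by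
    have hf : (fun x : ∀ n, E n => x 0) = ev 0 ∘ Preorder.frestrictLe 0 := rfl
    rw [hf, ← Measure.map_map (hev 0) (Preorder.measurable_frestrictLe 0), hQ, Kernel.trajMeasure,
      Measure.map_comp _ _ (Preorder.measurable_frestrictLe 0), Kernel.traj_map_frestrictLe,
      Kernel.partialTraj_self, Measure.id_comp]
    exact (Measure.map_map (hev 0) (MeasurableEquiv.measurable _)).trans Measure.map_id
  have hpair : ∀ n, Measurable fun y => (r n y, y) := fun n => (hr n).prodMk measurable_id
  -- the joint law of two consecutive coordinates
  have hjoint : ∀ n, Q.map (fun x => x n) = ν n →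
      Q.map (fun x => (x n, x (n + 1))) = (ν (n + 1)).map (fun y => (r n y, y)) := by
    intro n hn
    have h1 : Q.map (Preorder.frestrictLe n) ⊗ₘ κ n =
        Q.map (fun x => (Preorder.frestrictLe n x, x (n + 1))) :=
      Kernel.map_frestrictLe_trajMeasure_compProd_eq_map_trajMeasure
    have h2 : (ν (n + 1)).map (r n) ⊗ₘ condDistrib id (r n) (ν (n + 1)) =
        (ν (n + 1)).map (fun y => (r n y, y)) :=
      compProd_map_condDistrib measurable_id.aemeasurable
    have hm : Measurable (fun x : ∀ n, E n => (Preorder.frestrictLe n x, x (n + 1))) :=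
      (Preorder.measurable_frestrictLe n).prodMk (hev' _)
    have hm2 : Measurable (Prod.map (ev n) (id : E (n + 1) → E (n + 1))) :=
      (hev n).prodMap measurable_id
    have hc : (fun x : ∀ n, E n => (x n, x (n + 1))) =
        Prod.map (ev n) id ∘ fun x => (Preorder.frestrictLe n x, x (n + 1)) := rfl
    rw [← h2, hν n, ← hn, hc, ← Measure.map_map hm2 hm, ← h1]
    ext s hs
    have hfc : (fun x : ∀ n, E n => x n) = ev n ∘ Preorder.frestrictLe n := rfl
    rw [Measure.map_apply hm2 hs, Measure.compProd_apply (hm2 hs), Measure.compProd_apply hs, hfc,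
      ← Measure.map_map (hev n) (Preorder.measurable_frestrictLe n),
      lintegral_map (Kernel.measurable_kernel_prodMk_left hs) (hev n)]
    rfl
  have hlaw : ∀ n, Q.map (fun x => x n) = ν n := by
    intro n
    induction n with
    | zero => exact h0
    | succ n ih =>
      have h1 := congrArg (Measure.map Prod.snd) (hjoint n ih)
      rw [Measure.map_map measurable_snd ((hev' _).prodMk (hev' _)),
        Measure.map_map measurable_snd (hpair n)] at h1
      exact h1.trans Measure.map_id
  refine ⟨Q, inferInstance, hlaw, ae_all_iff.2 fun n => ?_⟩
  have hset : MeasurableSet {p : E n × E (n + 1) | r n p.2 = p.1} :=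
    measurableSet_eq_fun ((hr n).comp measurable_snd) measurable_fst
  have h1 : ∀ᵐ p ∂(Q.map (fun x => (x n, x (n + 1)))), r n p.2 = p.1 := by
    rw [hjoint n (hlaw n), ae_map_iff (hpair n).aemeasurable hset]
    exact Filter.Eventually.of_forall fun y => rfl
  exact (ae_map_iff ((hev' _).prodMk (hev' _)).aemeasurable hset).1 h1

end InverseLimit

/-! ### The infinite-volume field and the martingale -/

section InfiniteVolume

variable {V : Type*} [DecidableEq V] (G : WeightedGraph V)

open WeightedGraph

/-- The infinite-volume field, realized by coordinates: the inverse limit of the wired laws. -/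
lemma exists_infiniteVolumeField (hsum : ∀ i, Summable (G.W i))
    (Vn : ℕ → Finset V) (hmono : Monotone Vn) (hexh : ∀ i, ∃ n, i ∈ Vn n)
    (hconn : ∀ n, (G.wired (Vn n)).graph.Connected) :
    ∃ P : Measure (V → ℝ × ℝ), IsProbabilityMeasure P ∧
      IsInfiniteVolumeField G Vn P (fun i ω => (ω i).1) (fun i ω => (ω i).2) := by
  have hprob : ∀ n, IsProbabilityMeasure (wiredLaw G (Vn n)) :=
    fun n => isProbabilityMeasure_wiredLaw G _
  obtain ⟨Q, hQ, hlaw, hcomp⟩ := exists_inverseLimit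
    (E := fun n => (Vn n → ℝ) × (Vn n → ℝ)) (fun n => wiredLaw G (Vn n))
    (fun n => restrictPair (hmono n.le_succ)) (fun n => measurable_restrictPair _)
    (fun n => wiredLaw_map_restrictPair G hsum _)
  choose k hk using hexh
  let Φ : (∀ n, (Vn n → ℝ) × (Vn n → ℝ)) → V → ℝ × ℝ := fun x i =>
    ((x (k i)).1 ⟨i, hk i⟩, (x (k i)).2 ⟨i, hk i⟩)
  have hΦ : Measurable Φ := by fun_prop
  refine ⟨Q.map Φ, Measure.isProbabilityMeasure_map hΦ.aemeasurable, by fun_prop, by fun_prop,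
    fun n => ?_⟩
  have hrestr : Measurable fun ω : V → ℝ × ℝ =>
      ((fun i : Vn n => (ω i).1), (fun i : Vn n => (ω i).2)) := by fun_prop
  rw [map_betaTheta_sigmaMeasure _ (hconn n), Measure.map_map hrestr hΦ]
  change _ = wiredLaw G (Vn n)
  rw [← hlaw n]
  refine Measure.map_congr ?_
  filter_upwards [hcomp] with x hx
  have hle : ∀ m m' (h : m ≤ m'), restrictPair (hmono h) (x m') = x m := by
    intro m m' h
    induction m', h using Nat.le_induction with
    | base => rfl
    | succ m' h ih =>
      rw [← ih, ← hx m']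
      rfl
  have hagree : ∀ m m' i (hi : i ∈ Vn m) (hi' : i ∈ Vn m'),
      (x m).1 ⟨i, hi⟩ = (x m').1 ⟨i, hi'⟩ ∧ (x m).2 ⟨i, hi⟩ = (x m').2 ⟨i, hi'⟩ := by
    intro m m' i hi hi'
    rcases le_total m m' with h | h
    · rw [← hle m m' h]
      exact ⟨rfl, rfl⟩
    · rw [← hle m' m h]
      exact ⟨rfl, rfl⟩
  refine Prod.ext (funext fun i => ?_) (funext fun i => ?_)
  · exact (hagree _ _ i (hk i) i.2).1
  · exact (hagree _ _ i (hk i) i.2).2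

lemma measurable_AVV_inv {ι : Type*} [Fintype ι] [DecidableEq ι] (H : WeightedGraph (Option ι))
    (i j : ι) : Measurable fun u : Option ι → ℝ => (H.AVV u)⁻¹ i j := by
  refine measurable_matrix_inv (fun i j => ?_) i j
  simp only [AVV, A, Matrix.submatrix_apply, Matrix.of_apply]
  split_ifs
  · fun_prop
  · fun_prop

lemma measurable_recoverS {ι : Type*} [Fintype ι] [DecidableEq ι] (H : WeightedGraph (Option ι))
    {f : (ι → ℝ) → Option ι → ℝ} (hf : Measurable f) :
    Measurable fun x : (ι → ℝ) × (ι → ℝ) => H.recoverS f x.1 x.2 := by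
  refine measurable_pi_iff.2 fun o => ?_
  cases o with
  | none => exact measurable_const
  | some i =>
    simp only [recoverS, pin, Matrix.mulVec, dotProduct]
    have h1 : ∀ j, Measurable fun x : (ι → ℝ) × (ι → ℝ) => (H.AVV (f x.1))⁻¹ i j :=
      fun j => (measurable_AVV_inv H i j).comp (hf.comp measurable_fst)
    have h2 : ∀ j, Measurable fun x : (ι → ℝ) × (ι → ℝ) => f x.1 (some j) :=
      fun j => (measurable_pi_iff.1 hf (some j)).comp measurable_fst
    exact Finset.measurable_sum _ fun j _ => (h1 j).mul
      ((h2 j).exp.mul ((measurable_pi_apply j).comp measurable_snd))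

/-- The generating function as a function of `(β, θ)` through the recovered fields `(u, s)`. -/
lemma measurable_generatingFn_recover {ι : Type*} [Fintype ι] [DecidableEq ι]
    (H : WeightedGraph (Option ι)) {f : (ι → ℝ) → Option ι → ℝ} (hf : Measurable f)
    (a : Option ι → ℝ) : Measurable fun x : (ι → ℝ) × (ι → ℝ) =>
      generatingFn a (f x.1) (H.recoverS f x.1 x.2) := by
  have h1 := measurable_recoverS H hf
  have h2 : ∀ o, Measurable fun x : (ι → ℝ) × (ι → ℝ) => f x.1 o :=
    fun o => (measurable_pi_iff.1 hf o).comp measurable_fst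
  have h3 : ∀ o, Measurable fun x : (ι → ℝ) × (ι → ℝ) => H.recoverS f x.1 x.2 o :=
    measurable_pi_iff.1 h1
  unfold generatingFn
  fun_prop

/-- On `{H_β > 0}`, `e^u = H_β⁻¹ η` and `e^u s = H_β⁻¹ θ`. -/
lemma generatingFn_recover_eq {ι : Type*} [Fintype ι] [DecidableEq ι]
    (H : WeightedGraph (Option ι)) (hH : H.graph.Connected)
    {f : (ι → ℝ) → Option ι → ℝ} (hf : H.RecoversU f) (a : Option ι → ℝ)
    {x : (ι → ℝ) × (ι → ℝ)} (hx : (schrodinger (innerW H) x.1).PosDef) :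
    generatingFn a (f x.1) (H.recoverS f x.1 x.2) =
      genF (a none) (fun i => a (some i)) (innerW H) (outerW H) x := by
  set u := logGreen H x.1 with hu
  have hb : H.beta (pin u) = x.1 := beta_pin_logGreen H hH hx
  have hfu : f x.1 = pin u := by
    rw [← hb]
    exact hf.2 _ rfl
  have hop : opOfField H u = schrodinger (innerW H) x.1 := by rw [opOfField, hb]
  have hE : (schrodinger (innerW H) x.1)⁻¹.mulVec (outerW H) = expField u := by
    rw [← hop]
    exact expField_eq H hH u
  set y := (schrodinger (innerW H) x.1)⁻¹.mulVec x.2 with hy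
  set s : ι → ℝ := fun i => Real.exp (-u i) * y i with hs
  have hinv : ∀ i, Real.exp (u i) * s i = y i := fun i => by
    rw [hs, ← mul_assoc, ← Real.exp_add, add_neg_cancel, Real.exp_zero, one_mul]
  have hdet : IsUnit (H.AVV (pin u)).det := by
    rw [det_AVV]
    exact (mul_pos (posDef_opOfField H hH u).det_pos (by positivity)).ne'.isUnit
  have hAs : (H.AVV (pin u)).mulVec s = fun i => Real.exp (u i) * x.2 i := by
    have h1 : (Matrix.diagonal (expField u)).mulVec s = y := by
      ext i
      rw [Matrix.mulVec_diagonal]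
      exact hinv i
    rw [AVV_eq, ← Matrix.mulVec_mulVec, ← Matrix.mulVec_mulVec, h1, hop, mulVec_inv_mulVec hx]
    ext i
    rw [Matrix.mulVec_diagonal]
    rfl
  have hrec : H.recoverS f x.1 x.2 = pin s := by
    rw [recoverS, hfu]
    congr 1
    change (H.AVV (pin u))⁻¹.mulVec (fun i => Real.exp (u i) * x.2 i) = s
    rw [← hAs, Matrix.mulVec_mulVec, Matrix.nonsing_inv_mul _ hdet, Matrix.one_mulVec]
  rw [hrec, hfu, generatingFn, genF, green, green, hE, ← hy, Fintype.sum_option]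
  congr 1
  have h2 : ∀ i, (a (some i) : ℂ) * (Real.exp (u i) : ℂ) * (1 + Complex.I * (s i : ℂ)) =
      ((a (some i) * expField u i : ℝ) : ℂ) + Complex.I * ((a (some i) * y i : ℝ) : ℂ) := by
    intro i
    rw [← hinv, expField]
    push_cast
    ring
  simp only [pin, h2, Finset.sum_add_distrib, dotProduct, ← Finset.mul_sum]
  push_cast
  simp
  ring

/-- The generating functions form a martingale. -/
lemma martingale_generatingSeq (hsum : ∀ i, Summable (G.W i))
    (Vn : ℕ → Finset V) (hmono : Monotone Vn)
    (hconn : ∀ n, (G.wired (Vn n)).graph.Connected)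
    {Ω : Type*} [MeasurableSpace Ω] (P : Measure Ω) [IsProbabilityMeasure P]
    (β θ : V → Ω → ℝ) (hfield : IsInfiniteVolumeField G Vn P β θ)
    (f : (n : ℕ) → (Vn n → ℝ) → Option (Vn n) → ℝ)
    (hf : ∀ n, (G.wired (Vn n)).RecoversU (f n)) (α : V →₀ ℝ) (hα : ∀ i, α i ≤ 0) :
    Martingale (generatingSeq G Vn f β θ α)
      (fieldFiltration hmono hfield.measurable_beta hfield.measurable_theta) P := by
  set ℱ := fieldFiltration hmono hfield.measurable_beta hfield.measurable_theta with hℱ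
  let X : (n : ℕ) → Ω → (Vn n → ℝ) × (Vn n → ℝ) :=
    fun n ω => ((fun i : Vn n => β i ω), (fun i : Vn n => θ i ω))
  have hX : ∀ n, Measurable (X n) := by
    intro n
    have h1 := hfield.measurable_beta
    have h2 := hfield.measurable_theta
    change Measurable fun ω => ((fun i : Vn n => β i ω), (fun i : Vn n => θ i ω))
    fun_prop
  have hXF : ∀ n, Measurable[ℱ n] (X n) := fun n => comap_measurable (X n)
  have hlaw : ∀ n, P.map (X n) = wiredLaw G (Vn n) := fun n =>
    (hfield.law n).trans (map_betaTheta_sigmaMeasure _ (hconn n))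
  let N : (n : ℕ) → (Vn n → ℝ) × (Vn n → ℝ) → ℂ := fun n x =>
    generatingFn (wiredParam α (Vn n)) (f n x.1) ((G.wired (Vn n)).recoverS (f n) x.1 x.2)
  have hN : ∀ n, Measurable (N n) := fun n => measurable_generatingFn_recover _ (hf n).1 _
  have hMN : ∀ n, generatingSeq G Vn f β θ α n = N n ∘ X n := fun n => rfl
  have hNg : ∀ n, N n =ᵐ[wiredLaw G (Vn n)] wiredGen G α (Vn n) := by
    intro n
    filter_upwards [ae_law_posDef (innerW (G.wired (Vn n))) (innerW_isSymm _)
      (outerW (G.wired (Vn n)))] with x hx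
    exact generatingFn_recover_eq _ (hconn n) (hf n) _ hx
  have hint : ∀ n, Integrable (N n) (wiredLaw G (Vn n)) := by
    intro n
    have h := integrable_mul_genF (innerW_isSymm (G.wired (Vn n))) (innerW_nonneg _)
      (outerW_nonneg (G.wired (Vn n))) (fun i => wiredParam_nonpos hα (Vn n) (some i))
      (wiredParam_nonpos hα (Vn n) none) (g := fun _ => 1) measurable_const (C := 1) (by simp)
    simp only [one_mul] at h
    exact h.congr (hNg n).symm
  have hMint : ∀ n, Integrable (generatingSeq G Vn f β θ α n) P := by
    intro n
    have h := hint n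
    rw [← hlaw n] at h
    exact h.comp_measurable (hX n)
  -- integrals over cylinder sets, transported to the law of `(β, θ)`
  have hset : ∀ m n (hmn : m ≤ n) (B : Set ((Vn m → ℝ) × (Vn m → ℝ))), MeasurableSet B →
      ∫ ω in X m ⁻¹' B, generatingSeq G Vn f β θ α n ω ∂P =
        ∫ y, B.indicator (fun _ => (1 : ℂ)) y * wiredGen G α (Vn m) y
          ∂(wiredLaw G (Vn m)) := by
    intro m n hmn B hB
    have hgm : Measurable (B.indicator fun _ => (1 : ℂ)) := measurable_const.indicator hB
    have h1 : ∀ ω, (X m ⁻¹' B).indicator (generatingSeq G Vn f β θ α n) ω =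
        (fun x => B.indicator (fun _ => (1 : ℂ)) (restrictPair (hmono hmn) x) * N n x) (X n ω) := by
      intro ω
      have hr : restrictPair (hmono hmn) (X n ω) = X m ω := rfl
      dsimp only
      rw [hr, hMN]
      by_cases hω : X m ω ∈ B
      · rw [Set.indicator_of_mem (show ω ∈ X m ⁻¹' B from hω), Set.indicator_of_mem hω, one_mul]
        rfl
      · rw [Set.indicator_of_notMem (show ω ∉ X m ⁻¹' B from hω), Set.indicator_of_notMem hω,
          zero_mul]
    rw [← integral_indicator (hX m hB)]
    simp_rw [h1]
    have hm2 : Measurable fun x => B.indicator (fun _ => (1 : ℂ))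
        (restrictPair (hmono hmn) x) * N n x :=
      (hgm.comp (measurable_restrictPair _)).mul (hN n)
    rw [← integral_map (hX n).aemeasurable hm2.aestronglyMeasurable, hlaw n,
      ← integral_wiredGen_restrictPair G hsum hα (hmono hmn) hgm (C := 1)]
    · refine integral_congr_ae ?_
      filter_upwards [hNg n] with x hx
      rw [hx]
    · intro y
      by_cases hy : y ∈ B <;> simp [hy]
  refine ⟨fun n => ?_, fun m n hmn => ?_⟩
  · exact ((hN n).comp (hXF n)).stronglyMeasurable
  · refine (ae_eq_condExp_of_forall_setIntegral_eq (ℱ.le m) (hMint n)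
      (fun s _ _ => (hMint m).integrableOn) ?_ ?_).symm
    · rintro s ⟨B, hB, rfl⟩ _
      exact (hset m m le_rfl B hB).trans (hset m n hmn B hB).symm
    · exact ((hN m).comp (hXF m)).stronglyMeasurable.aestronglyMeasurable

end InfiniteVolume

end H22

theorem mainTheorem3 {V : Type*} [DecidableEq V] [Infinite V] (G : H22.WeightedGraph V)
    (hsum : ∀ i, Summable (G.W i))
    (Vn : ℕ → Finset V) (hmono : Monotone Vn) (hexh : ∀ i, ∃ n, i ∈ Vn n)
    (hconn : ∀ n, (G.wired (Vn n)).graph.Connected) :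
    (∃ P : Measure (V → ℝ × ℝ), IsProbabilityMeasure P ∧
      H22.IsInfiniteVolumeField G Vn P (fun i ω => (ω i).1) (fun i ω => (ω i).2)) ∧
    (∀ n, ∃ f : (Vn n → ℝ) → Option (Vn n) → ℝ, (G.wired (Vn n)).RecoversU f) ∧
    ∀ {Ω : Type*} [MeasurableSpace Ω] (P : Measure Ω) [IsProbabilityMeasure P]
      (β θ : V → Ω → ℝ) (hfield : H22.IsInfiniteVolumeField G Vn P β θ)
      (f : (n : ℕ) → (Vn n → ℝ) → Option (Vn n) → ℝ)
      (_hf : ∀ n, (G.wired (Vn n)).RecoversU (f n))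
      (α : V →₀ ℝ) (_hα : ∀ i, α i ≤ 0),
      Martingale (H22.generatingSeq G Vn f β θ α)
        (H22.fieldFiltration hmono hfield.measurable_beta hfield.measurable_theta) P := by
  refine ⟨H22.exists_infiniteVolumeField G hsum Vn hmono hexh hconn,
    fun n => H22.exists_recoversU _ (hconn n), ?_⟩
  intro Ω _ P _ β θ hfield f hf α hα
  exact H22.martingale_generatingSeq G hsum Vn hmono hconn P β θ hfield f hf α hα
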